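/- There is an absolute constant $c>0$ such that for every finite set $A$ of positive real numbers with $|A|\ge 2$, $$|A/A+A| \ \ge\ c\,\frac{|A|^{\frac32+\frac1{26}}}{(\log|A|)^{5/6}},$$ where $A/A+A=\{a/b+c' : a,b,c'\in A\}$ and $\log$ denotes the natural logarithm. -/

import Mathlib

open scoped Pointwise

/-! Write N = |A| and σ = |A/A + A|. The proof gives N^(31/5) ≪ σ^4 log² N, hence the exponent 31/20
= 3/2 + 1/20, which is stronger than needed. Pigeonholing the slopes a/b by multiplicity yields a
level τ such that the s lines through the origin with at least τ points of A × A satisfy τ s ≥ N²/H,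
where H is the N-th harmonic number (`exists_popular_level`). If (b, lb) lies on such a line, then
(b/c, lb/c) added to any point of A × A lands in the grid (A/A + A)², for every c in A. This is
exploited in two ways.

If τ ≤ N^(2/3), points are translated along lines of slope l. Each such line meeting A × A has at
least N points of the larger grid, and about Nκ of them if it has at least κ points of A × A, where
κ^5 is about τ²/N (`card_add_div_growth`). Szemerédi–Trotter allows few such lines, yet together
they carry sN² incidences with A × A (`card_richSlopes_mul_le`).

If τ ≥ N^(2/3), vectors from different lines are added, in the manner of Solymosi. The rich slopes
are cut into blocks of 2M consecutive ones, M ≈ N^(1/9). Sums formed in different blocks have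
different slopes, and inside a block Szemerédi–Trotter bounds the coincidences, leaving ≫ M²Nτ
distinct sums (`card_cluster_sums`). Hence σ² ≫ (s/M) M²Nτ (`card_blocks_mul_le`).

All incidences concern Cartesian products, where Szemerédi–Trotter is elementary
(`grid_incidences_le`): a line is monotone, so it meets at most about 2r cells of an r × r
partition. -/

/-! ### Szemerédi–Trotter for grids -/

/-- A finite set of reals is cut by a monotone index function into `r` blocks of nearly equal
size; the number of ordered pairs of distinct elements in a common block is then small. -/
theorem exists_monotone_block_index (P : Finset ℝ) {r : ℕ} (hr : 0 < r) :
    ∃ f : ℝ → ℕ, Monotone f ∧ (∀ x ∈ P, f x < r) ∧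
      ((P ×ˢ P).filter fun z => z.1 ≠ z.2 ∧ f z.1 = f z.2).card * r ≤ P.card * P.card := by
  classical
  -- The `+ 1` gives r * w > |P|, so at most r blocks occur, while an element shares its block with
  -- at most w - 1 ≤ |P| / r others.
  set w := P.card / r + 1 with hw
  set ρ : ℝ → ℕ := fun x => (P.filter (· < x)).card with hρ
  have hmono : Monotone ρ := by
    intro x y hxy
    refine Finset.card_le_card fun z hz => ?_
    rw [Finset.mem_filter] at hz ⊢
    exact ⟨hz.1, hz.2.trans_le hxy⟩
  have hlt : ∀ x ∈ P, ∀ y, x < y → ρ x < ρ y := by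
    intro x hx y hxy
    refine Finset.card_lt_card ?_
    rw [Finset.ssubset_iff_of_subset]
    · exact ⟨x, by simp [hx, hxy], by simp⟩
    · intro z hz
      rw [Finset.mem_filter] at hz ⊢
      exact ⟨hz.1, hz.2.trans hxy⟩
  have hρinj : Set.InjOn ρ P := by
    intro x hx y hy h
    rcases lt_trichotomy x y with h1 | h1 | h1
    · exact absurd h (hlt x hx y h1).ne
    · exact h1
    · exact absurd h (hlt y hy x h1).ne'
  have hwpos : 0 < w := Nat.succ_pos _
  refine ⟨fun x => ρ x / w, fun x y hxy => Nat.div_le_div_right (hmono hxy), ?_, ?_⟩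
  · intro x hx
    have h1 : ρ x < P.card := by
      refine Finset.card_lt_card ?_
      rw [Finset.ssubset_iff_of_subset (Finset.filter_subset _ _)]
      exact ⟨x, hx, by simp⟩
    have h2 : P.card < r * w := by
      rw [hw, mul_add, mul_one]
      exact Nat.lt_mul_div_succ _ hr
    exact Nat.div_lt_of_lt_mul (by rw [mul_comm]; omega)
  · have hfib : ∀ x ∈ P, (P.filter fun y => x ≠ y ∧ ρ x / w = ρ y / w).card ≤ P.card / r := by
      intro x hx
      have h1 : (P.filter fun y => ρ x / w = ρ y / w).card ≤ w := by
        have : (P.filter fun y => ρ x / w = ρ y / w).card ≤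
            (Finset.Ico (ρ x / w * w) (ρ x / w * w + w)).card := by
          refine Finset.card_le_card_of_injOn ρ ?_ ?_
          · intro y hy
            simp only [Finset.mem_coe, Finset.mem_filter] at hy
            simp only [Finset.coe_Ico, Set.mem_Ico]
            rw [hy.2]
            exact ⟨Nat.div_mul_le_self _ _, Nat.lt_div_mul_add hwpos⟩
          · exact hρinj.mono (by exact_mod_cast Finset.filter_subset _ _)
        simpa using this
      have h2 : (P.filter fun y => x ≠ y ∧ ρ x / w = ρ y / w) ⊆
          (P.filter fun y => ρ x / w = ρ y / w).erase x := by
        intro y hy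
        simp only [Finset.mem_filter, Finset.mem_erase] at hy ⊢
        exact ⟨hy.2.1.symm, hy.1, hy.2.2⟩
      have h3 := Finset.card_le_card h2
      rw [Finset.card_erase_of_mem (by simp [hx])] at h3
      omega
    have hsum : ((P ×ˢ P).filter fun z => z.1 ≠ z.2 ∧ ρ z.1 / w = ρ z.2 / w).card ≤
        P.card * (P.card / r) := by
      rw [Finset.card_filter, Finset.sum_product, ← smul_eq_mul, ← Finset.sum_const]
      refine Finset.sum_le_sum fun x hx => ?_
      rw [← Finset.card_filter]
      exact hfib x hx
    calc _ ≤ P.card * (P.card / r) * r := Nat.mul_le_mul_right _ hsum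
      _ ≤ P.card * P.card := by
        rw [mul_assoc]
        exact Nat.mul_le_mul_left _ (Nat.div_mul_le_self _ _)

/-- A finite set is no larger than the number of colours used on it plus the number of ordered
pairs of distinct elements of equal colour. -/
theorem card_le_add_card_monochromatic {α : Type*} [DecidableEq α] (T : Finset α) (h : α → ℕ)
    {n : ℕ} (hn : ∀ x ∈ T, h x < n) :
    T.card ≤ n + ((T ×ˢ T).filter fun z => z.1 ≠ z.2 ∧ h z.1 = h z.2).card := by
  classical
  rcases T.eq_empty_or_nonempty with rfl | ⟨x0, hx0⟩
  · simp
  -- One representative per colour: the representatives number at most n, and every other element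
  -- forms a monochromatic pair with its own.
  have hrep : ∃ rep : ℕ → α, ∀ x ∈ T, rep (h x) ∈ T ∧ h (rep (h x)) = h x := by
    have : ∀ i, ∃ y ∈ T, (∃ x ∈ T, h x = i) → h y = i := by
      intro i
      by_cases hi : ∃ x ∈ T, h x = i
      · obtain ⟨x, hx, hxi⟩ := hi
        exact ⟨x, hx, fun _ => hxi⟩
      · exact ⟨x0, hx0, fun h => absurd h hi⟩
    choose rep hrep1 hrep2 using this
    exact ⟨rep, fun x hx => ⟨hrep1 _, hrep2 _ ⟨x, hx, rfl⟩⟩⟩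
  obtain ⟨rep, hrep⟩ := hrep
  have hsplit := Finset.card_filter_add_card_filter_not (s := T) (fun x => rep (h x) = x)
  have h1 : (T.filter fun x => rep (h x) = x).card ≤ n := by
    have : (T.filter fun x => rep (h x) = x).card ≤ (Finset.range n).card := by
      refine Finset.card_le_card_of_injOn h ?_ ?_
      · intro x hx
        simp only [Finset.mem_coe, Finset.mem_filter] at hx
        simpa using hn x hx.1
      · intro x hx y hy hxy
        simp only [Finset.mem_coe, Finset.mem_filter] at hx hy
        rw [← hx.2, ← hy.2, hxy]
    simpa using this
  have h2 : (T.filter fun x => ¬ rep (h x) = x).card ≤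
      ((T ×ˢ T).filter fun z => z.1 ≠ z.2 ∧ h z.1 = h z.2).card := by
    refine Finset.card_le_card_of_injOn (fun x => (rep (h x), x)) ?_ ?_
    · intro x hx
      simp only [Finset.mem_coe, Finset.mem_filter] at hx
      simp only [Finset.mem_coe, Finset.mem_filter, Finset.mem_product]
      exact ⟨⟨(hrep x hx.1).1, hx.1⟩, hx.2, (hrep x hx.1).2⟩
    · intro x _ y _ hxy
      exact (Prod.ext_iff.1 hxy).2
  omega

/-- Incidence bound for the points of a grid `P × Q` and a finite family of distinct lines of
nonzero slope, with `r` blocks in each direction. -/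
theorem grid_incidences_le_blocks {ι : Type*} (P Q : Finset ℝ) (J : Finset ι) (m k : ι → ℝ)
    (hm : ∀ i ∈ J, m i ≠ 0) (hinj : Set.InjOn (fun i => (m i, k i)) J) {r : ℕ} (hr : 0 < r) :
    (∑ i ∈ J, (P.filter fun x => m i * x + k i ∈ Q).card) * (r * r) ≤
      2 * r * J.card * (r * r) + (P.card * P.card) * (Q.card * Q.card) := by
  classical
  obtain ⟨f, hf, hfr, hfP⟩ := exists_monotone_block_index P hr
  obtain ⟨g, hg, hgr, hgQ⟩ := exists_monotone_block_index Q hr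
  set PP := (P ×ˢ P).filter fun z => z.1 ≠ z.2 ∧ f z.1 = f z.2 with hPP
  set QQ := (Q ×ˢ Q).filter fun z => z.1 ≠ z.2 ∧ g z.1 = g z.2 with hQQ
  set T : ι → Finset ℝ := fun i => P.filter fun x => m i * x + k i ∈ Q with hT
  set R : ι → Finset (ℝ × ℝ) := fun i => (T i ×ˢ T i).filter fun z =>
    z.1 ≠ z.2 ∧ f z.1 = f z.2 ∧ g (m i * z.1 + k i) = g (m i * z.2 + k i) with hR
  have hline : ∀ i ∈ J, (T i).card ≤ 2 * r + (R i).card := by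
    intro i hi
    have hTP : ∀ x ∈ T i, x ∈ P ∧ m i * x + k i ∈ Q := fun x hx => by
      simpa [hT] using hx
    rcases lt_or_gt_of_ne (hm i hi) with hneg | hpos
    -- Along a decreasing line `f` and `r - g` are monotone in the same direction, so equality of
    -- their sums forces equality of both block indices. The truncated subtraction is harmless since
    -- `g < r` on `Q`.
    · have h1 := card_le_add_card_monochromatic (T i)
        (fun x => f x + (r - g (m i * x + k i))) (n := 2 * r) (fun x hx => by
          have := hfr x (hTP x hx).1
          omega)
      refine h1.trans (Nat.add_le_add_left (Finset.card_le_card ?_) _)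
      intro z hz
      simp only [hR, Finset.mem_filter, Finset.mem_product] at hz ⊢
      obtain ⟨⟨h1, h2⟩, h3, h4⟩ := hz
      have g1 := hgr _ (hTP _ h1).2
      have g2 := hgr _ (hTP _ h2).2
      refine ⟨⟨h1, h2⟩, h3, ?_⟩
      rcases le_total z.1 z.2 with hle | hle
      · have a1 := hf hle
        have a2 : g (m i * z.2 + k i) ≤ g (m i * z.1 + k i) := hg (by nlinarith)
        omega
      · have a1 := hf hle
        have a2 : g (m i * z.1 + k i) ≤ g (m i * z.2 + k i) := hg (by nlinarith)
        omega
    · have h1 := card_le_add_card_monochromatic (T i)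
        (fun x => f x + g (m i * x + k i)) (n := 2 * r) (fun x hx => by
          have := hfr x (hTP x hx).1
          have := hgr _ (hTP x hx).2
          omega)
      refine h1.trans (Nat.add_le_add_left (Finset.card_le_card ?_) _)
      intro z hz
      simp only [hR, Finset.mem_filter, Finset.mem_product] at hz ⊢
      obtain ⟨⟨h1, h2⟩, h3, h4⟩ := hz
      refine ⟨⟨h1, h2⟩, h3, ?_⟩
      rcases le_total z.1 z.2 with hle | hle
      · have a1 := hf hle
        have a2 : g (m i * z.1 + k i) ≤ g (m i * z.2 + k i) := hg (by nlinarith)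
        omega
      · have a1 := hf hle
        have a2 : g (m i * z.2 + k i) ≤ g (m i * z.1 + k i) := hg (by nlinarith)
        omega
  -- Two distinct points determine their line, so the pair of abscissae and the pair of ordinates
  -- recover `i`.
  have hpairs : ∑ i ∈ J, (R i).card ≤ PP.card * QQ.card := by
    rw [← Finset.card_sigma, ← Finset.card_product]
    refine Finset.card_le_card_of_injOn
      (fun z => (z.2, (m z.1 * z.2.1 + k z.1, m z.1 * z.2.2 + k z.1))) ?_ ?_
    · rintro ⟨i, x, x'⟩ hz
      simp only [Finset.coe_sigma, Set.mem_sigma_iff, Finset.mem_coe, hR, hT, Finset.mem_filter,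
        Finset.mem_product] at hz
      obtain ⟨hi, ⟨⟨hx, hy⟩, hx', hy'⟩, hne, hfx, hgx⟩ := hz
      simp only [hPP, hQQ, Finset.coe_product, Set.mem_prod, Finset.mem_coe, Finset.mem_filter,
        Finset.mem_product]
      refine ⟨⟨⟨hx, hx'⟩, hne, hfx⟩, ⟨hy, hy'⟩, ?_, hgx⟩
      intro h
      exact hne (mul_left_cancel₀ (hm i hi) (add_right_cancel h))
    · rintro ⟨i, x, x'⟩ hz ⟨j, y, y'⟩ hw h
      simp only [Finset.coe_sigma, Set.mem_sigma_iff, Finset.mem_coe, hR, hT, Finset.mem_filter,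
        Finset.mem_product] at hz hw
      simp only [Prod.mk.injEq] at h
      obtain ⟨⟨rfl, rfl⟩, h1, h2⟩ := h
      have hne : x - x' ≠ 0 := sub_ne_zero.2 hz.2.2.1
      have hmm : m i = m j := by
        apply mul_right_cancel₀ hne
        linarith
      have hkk : k i = k j := by
        rw [hmm] at h1
        linarith
      have : i = j := hinj hz.1 hw.1 (by simp [hmm, hkk])
      subst this
      rfl
  have hsum : ∑ i ∈ J, (T i).card ≤ 2 * r * J.card + PP.card * QQ.card := by
    calc _ ≤ ∑ i ∈ J, (2 * r + (R i).card) := Finset.sum_le_sum hline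
      _ = 2 * r * J.card + ∑ i ∈ J, (R i).card := by
        rw [Finset.sum_add_distrib, Finset.sum_const, smul_eq_mul, mul_comm J.card]
      _ ≤ _ := Nat.add_le_add_left hpairs _
  calc _ ≤ (2 * r * J.card + PP.card * QQ.card) * (r * r) := Nat.mul_le_mul_right _ hsum
    _ = 2 * r * J.card * (r * r) + (PP.card * r) * (QQ.card * r) := by ring
    _ ≤ _ := Nat.add_le_add_left (Nat.mul_le_mul hfP hgQ) _

/-- Two-thirds powers are squares of cube roots. -/
theorem exists_cube_root {x : ℝ} (hx : 0 ≤ x) :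
    ∃ y : ℝ, 0 ≤ y ∧ y ^ 3 = x ∧ x ^ ((2 : ℝ) / 3) = y ^ 2 := by
  refine ⟨x ^ ((1 : ℝ) / 3), by positivity, ?_, ?_⟩
  · rw [← Real.rpow_natCast, ← Real.rpow_mul hx]
    norm_num
  · rw [← Real.rpow_natCast, ← Real.rpow_mul hx]
    norm_num

/-- The Szemerédi–Trotter bound for the points of a grid. -/
theorem grid_incidences_le {ι : Type*} (P Q : Finset ℝ) (J : Finset ι) (m k : ι → ℝ)
    (hm : ∀ i ∈ J, m i ≠ 0) (hinj : Set.InjOn (fun i => (m i, k i)) J) :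
    ((∑ i ∈ J, (P.filter fun x => m i * x + k i ∈ Q).card : ℕ) : ℝ) ≤
      3 * ((P.card : ℝ) * Q.card * J.card) ^ ((2 : ℝ) / 3) + 2 * J.card := by
  classical
  rcases J.eq_empty_or_nonempty with rfl | hJ
  · simp
  have hJ0 : (0 : ℝ) < J.card := by exact_mod_cast hJ.card_pos
  rcases P.eq_empty_or_nonempty with rfl | hP
  · simp
  rcases Q.eq_empty_or_nonempty with rfl | hQ
  · simp
  have hP0 : (0 : ℝ) < P.card := by exact_mod_cast hP.card_pos
  have hQ0 : (0 : ℝ) < Q.card := by exact_mod_cast hQ.card_pos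
  obtain ⟨y, hy0, hy3, hy2⟩ := exists_cube_root
    (show 0 ≤ (P.card : ℝ) * Q.card * J.card by positivity)
  have hypos : 0 < y := by
    refine hy0.lt_of_ne' fun h => ?_
    have : (P.card : ℝ) * Q.card * J.card = 0 := by rw [← hy3, h]; norm_num
    exact absurd this (by positivity)
  rw [hy2]
  -- This number of blocks balances 2r|J| against (|P||Q|)²/r², since (|P||Q|)² = y²ρ².
  set ρ : ℝ := y ^ 2 / J.card with hρ
  have hρpos : 0 < ρ := by positivity
  set r := ⌈ρ⌉₊ with hr
  have hr0 : 0 < r := Nat.ceil_pos.2 hρpos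
  have hrρ : ρ ≤ r := Nat.le_ceil _
  have hrρ' : (r : ℝ) ≤ ρ + 1 := (Nat.ceil_lt_add_one hρpos.le).le
  have key := grid_incidences_le_blocks P Q J m k hm hinj hr0
  set I := ∑ i ∈ J, (P.filter fun x => m i * x + k i ∈ Q).card with hI
  have key' : (I : ℝ) * (r * r) ≤ 2 * r * J.card * (r * r) +
      (P.card * P.card) * (Q.card * Q.card) := by exact_mod_cast key
  have hρJ : ρ * J.card = y ^ 2 := by
    rw [hρ]
    field_simp
  have hpq : ((P.card : ℝ) * P.card) * (Q.card * Q.card) = y ^ 2 * (ρ * ρ) := by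
    have : (P.card : ℝ) * Q.card = y ^ 3 / J.card := by
      rw [hy3]
      field_simp
    calc ((P.card : ℝ) * P.card) * (Q.card * Q.card) = (P.card * Q.card) ^ 2 := by ring
      _ = _ := by
        rw [this, hρ]
        ring
  have hrr : (0 : ℝ) < r * r := by positivity
  have h1 : (I : ℝ) * (r * r) ≤ (2 * r * J.card + y ^ 2) * (r * r) := by
    calc _ ≤ 2 * r * J.card * (r * r) + y ^ 2 * (ρ * ρ) := by rw [← hpq]; exact key'
      _ ≤ 2 * r * J.card * (r * r) + y ^ 2 * (r * r) := by gcongr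
      _ = _ := by ring
  have h2 : (I : ℝ) ≤ 2 * r * J.card + y ^ 2 := le_of_mul_le_mul_right h1 hrr
  nlinarith [mul_le_mul_of_nonneg_right hrρ' hJ0.le]

/-- A family of distinct lines of nonzero slope, each containing at least `n` points of a grid. -/
theorem card_rich_lines_mul_le {ι : Type*} (P Q : Finset ℝ) (J : Finset ι) (m k : ι → ℝ)
    (hm : ∀ i ∈ J, m i ≠ 0) (hinj : Set.InjOn (fun i => (m i, k i)) J) {n : ℝ} (hn : 4 ≤ n)
    (hrich : ∀ i ∈ J, n ≤ ((P.filter fun x => m i * x + k i ∈ Q).card : ℝ)) :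
    (J.card : ℝ) * n ^ 3 ≤ 216 * ((P.card : ℝ) * Q.card) ^ 2 := by
  have key := grid_incidences_le P Q J m k hm hinj
  have h1 : (J.card : ℝ) * n ≤
      ((∑ i ∈ J, (P.filter fun x => m i * x + k i ∈ Q).card : ℕ) : ℝ) := by
    push_cast
    rw [← nsmul_eq_mul]
    exact Finset.card_nsmul_le_sum _ _ _ hrich
  rcases J.eq_empty_or_nonempty with rfl | hJ
  · simp only [Finset.card_empty, Nat.cast_zero, zero_mul]
    positivity
  have hJ0 : (0 : ℝ) < J.card := by exact_mod_cast hJ.card_pos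
  obtain ⟨y, hypos, hy3, hy2⟩ := exists_cube_root
    (show 0 ≤ (P.card : ℝ) * Q.card * J.card by positivity)
  rw [hy2] at key
  -- As n ≥ 4, the term 2|J| is at most half of |J| n and is absorbed.
  have h2 : (J.card : ℝ) * n ≤ 6 * y ^ 2 := by nlinarith
  have h3 : ((J.card : ℝ) * n) ^ 3 ≤ (6 * y ^ 2) ^ 3 := by gcongr
  have h4 : (6 * y ^ 2) ^ 3 = 216 * ((P.card : ℝ) * Q.card * J.card) ^ 2 := by
    rw [← hy3]
    ring
  rw [h4] at h3
  have h5 : (J.card : ℝ) ^ 2 * (J.card * n ^ 3) ≤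
      (J.card : ℝ) ^ 2 * (216 * ((P.card : ℝ) * Q.card) ^ 2) := by
    calc _ = ((J.card : ℝ) * n) ^ 3 := by ring
      _ ≤ _ := h3
      _ = _ := by ring
  exact le_of_mul_le_mul_left h5 (by positivity)

/-- Incidences on the lines containing at least `k ≥ 4` points of a grid. -/
theorem rich_incidences_mul_le {ι : Type*} (P Q : Finset ℝ) (J : Finset ι) (m c : ι → ℝ)
    (hm : ∀ i ∈ J, m i ≠ 0) (hinj : Set.InjOn (fun i => (m i, c i)) J) {k : ℝ} (hk : 4 ≤ k)
    (hrich : ∀ i ∈ J, k ≤ ((P.filter fun x => m i * x + c i ∈ Q).card : ℝ)) :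
    (∑ i ∈ J, ((P.filter fun x => m i * x + c i ∈ Q).card : ℝ)) * k ^ 2 ≤
      216 * ((P.card : ℝ) * Q.card) ^ 2 := by
  have h1 := grid_incidences_le P Q J m c hm hinj
  push_cast at h1
  have h3 : (J.card : ℝ) * k ≤ ∑ i ∈ J, ((P.filter fun x => m i * x + c i ∈ Q).card : ℝ) := by
    rw [← nsmul_eq_mul]
    exact Finset.card_nsmul_le_sum _ _ _ hrich
  obtain ⟨y, hy0, hy3, hy2⟩ := exists_cube_root
    (show 0 ≤ (P.card : ℝ) * Q.card * J.card by positivity)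
  rw [hy2] at h1
  generalize (∑ i ∈ J, ((P.filter fun x => m i * x + c i ∈ Q).card : ℝ)) = I at h1 h3 ⊢
  generalize (P.card : ℝ) = p at *
  generalize (Q.card : ℝ) = q at *
  have hJ0 : (0 : ℝ) ≤ J.card := Nat.cast_nonneg _
  generalize (J.card : ℝ) = L at *
  have h4 : I ≤ 6 * y ^ 2 := by nlinarith
  have hI0 : 0 ≤ I := le_trans (by positivity) h3
  -- After cubing, the unknown number L of lines appears as (Lk)², which is at most I².
  have h5 : I ^ 3 * k ^ 2 ≤ 216 * (p * q) ^ 2 * I ^ 2 := by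
    calc I ^ 3 * k ^ 2 ≤ (6 * y ^ 2) ^ 3 * k ^ 2 := by gcongr
      _ = 216 * (y ^ 3) ^ 2 * k ^ 2 := by ring
      _ = 216 * (p * q) ^ 2 * (L * k) ^ 2 := by
        rw [hy3]
        ring
      _ ≤ 216 * (p * q) ^ 2 * I ^ 2 := by gcongr
  rcases hI0.eq_or_lt with h0 | h0
  · rw [← h0, zero_mul]
    positivity
  have : I ^ 2 * (I * k ^ 2) ≤ I ^ 2 * (216 * (p * q) ^ 2) := by linarith
  exact le_of_mul_le_mul_left this (by positivity)

/-! ### Popular slopes -/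

/-- The abscissae of the points of `A × A` on the line of slope `l` through the origin. -/
noncomputable def slopeFiber (A : Finset ℝ) (l : ℝ) : Finset ℝ := A.filter fun b => l * b ∈ A

theorem mem_slopeFiber {A : Finset ℝ} {l b : ℝ} : b ∈ slopeFiber A l ↔ b ∈ A ∧ l * b ∈ A :=
  Finset.mem_filter

theorem sum_card_slopeFiber {A : Finset ℝ} (hA : ∀ a ∈ A, 0 < a) :
    ∑ l ∈ A / A, (slopeFiber A l).card = A.card * A.card := by
  classical
  rw [← Finset.card_product, ← Finset.card_sigma]
  refine Finset.card_bij' (fun z _ => (z.1 * z.2, z.2)) (fun w _ => ⟨w.1 / w.2, w.2⟩) ?_ ?_ ?_ ?_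
  · rintro ⟨l, b⟩ h
    simp only [Finset.mem_sigma, mem_slopeFiber] at h
    simp [h.2.1, h.2.2]
  · rintro ⟨a, b⟩ h
    simp only [Finset.mem_product] at h
    have hb := (hA b h.2).ne'
    simp only [Finset.mem_sigma, mem_slopeFiber]
    refine ⟨Finset.div_mem_div h.1 h.2, h.2, ?_⟩
    rw [div_mul_cancel₀ _ hb]
    exact h.1
  · rintro ⟨l, b⟩ h
    simp only [Finset.mem_sigma, mem_slopeFiber] at h
    have hb := (hA b h.2.1).ne'
    simp [hb]
  · rintro ⟨a, b⟩ h
    simp only [Finset.mem_product] at h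
    have hb := (hA b h.2).ne'
    simp [hb]

/-- The slopes whose line through the origin has at least `τ` points in `A × A`. -/
noncomputable def richSlopes (A : Finset ℝ) (τ : ℕ) : Finset ℝ :=
  (A / A).filter fun l => τ ≤ (slopeFiber A l).card

/-- Some level of richness carries a `1 / log` proportion of `A × A`. -/
theorem exists_popular_level {A : Finset ℝ} (hA : ∀ a ∈ A, 0 < a) (hne : A.Nonempty) :
    ∃ τ : ℕ, 1 ≤ τ ∧ τ ≤ A.card ∧
      (A.card : ℝ) ^ 2 ≤ (harmonic A.card : ℝ) * (τ * (richSlopes A τ).card) := by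
  classical
  by_contra! hcon
  set N := A.card with hN
  have hN0 : 0 < N := hne.card_pos
  -- Each slope is counted once per level up to its richness, so the levels total N². If every level
  -- failed, they would total less than (N²/H) ∑ 1/τ = N².
  have hsum : ∑ τ ∈ Finset.Icc 1 N, (richSlopes A τ).card = N * N := by
    rw [← sum_card_slopeFiber hA]
    simp only [richSlopes, Finset.card_filter]
    rw [Finset.sum_comm]
    refine Finset.sum_congr rfl fun l _ => ?_
    rw [← Finset.card_filter]
    have hle : (slopeFiber A l).card ≤ N := Finset.card_le_card (Finset.filter_subset _ _)
    have : (Finset.Icc 1 N).filter (fun τ => τ ≤ (slopeFiber A l).card) =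
        Finset.Icc 1 (slopeFiber A l).card := by
      ext τ
      simp only [Finset.mem_filter, Finset.mem_Icc]
      omega
    rw [this, Nat.card_Icc, Nat.add_sub_cancel]
  have hH : (0 : ℝ) < harmonic N := by exact_mod_cast harmonic_pos hN0.ne'
  have hlt : ∑ τ ∈ Finset.Icc 1 N, ((richSlopes A τ).card : ℝ) <
      ∑ τ ∈ Finset.Icc 1 N, (N : ℝ) ^ 2 / harmonic N * (τ : ℝ)⁻¹ := by
    refine Finset.sum_lt_sum_of_nonempty ⟨1, by simp; omega⟩ fun τ hτ => ?_
    rw [Finset.mem_Icc] at hτ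
    have h1 := hcon τ hτ.1 hτ.2
    have h2 : (0 : ℝ) < τ := by exact_mod_cast hτ.1
    rw [← div_eq_mul_inv, div_div, lt_div_iff₀ (by positivity)]
    linarith
  rw [← Finset.mul_sum] at hlt
  have hharm : ∑ τ ∈ Finset.Icc 1 N, ((τ : ℝ))⁻¹ = (harmonic N : ℝ) := by
    rw [harmonic_eq_sum_Icc]
    push_cast
    rfl
  rw [hharm, div_mul_cancel₀ _ hH.ne', ← Nat.cast_sum, hsum] at hlt
  push_cast at hlt
  nlinarith

/-! ### Growth of sums z + b/c -/

/-- Cauchy–Schwarz: few coincidences of a map force a large image. -/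
theorem card_sq_le_card_mul_card_coincidences {α β : Type*} [DecidableEq β] (X : Finset α)
    (f : α → β) (U : Finset β) (hU : ∀ x ∈ X, f x ∈ U) :
    X.card ^ 2 ≤ U.card * ((X ×ˢ X).filter fun z => f z.1 = f z.2).card := by
  classical
  have h1 : X.card = ∑ u ∈ U, (X.filter fun x => f x = u).card :=
    Finset.card_eq_sum_card_fiberwise hU
  have h2 : ((X ×ˢ X).filter fun z => f z.1 = f z.2).card =
      ∑ u ∈ U, (X.filter fun x => f x = u).card ^ 2 := by
    rw [Finset.card_eq_sum_card_fiberwise (f := fun z => f z.1) (t := U)]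
    · refine Finset.sum_congr rfl fun u _ => ?_
      rw [sq, ← Finset.card_product]
      congr 1
      ext z
      simp only [Finset.mem_filter, Finset.mem_product]
      constructor
      · rintro ⟨⟨⟨h1, h2⟩, h3⟩, h4⟩
        exact ⟨⟨h1, h4⟩, h2, h3 ▸ h4⟩
      · rintro ⟨⟨h1, h2⟩, h3, h4⟩
        exact ⟨⟨⟨h1, h3⟩, h2.trans h4.symm⟩, h2⟩
    · intro z hz
      simp only [Finset.coe_filter, Finset.mem_product] at hz
      exact hU _ hz.1.1
  rw [h1, h2]
  exact sq_sum_le_card_mul_sum_sq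

/-- Representations of a nonzero `d` as `b / c' - b / c`, on average over `b ∈ B`, in terms of the
size of the quotient set `B / A`. -/
theorem card_mul_card_dilated_differences_le {A B : Finset ℝ} (hA : ∀ a ∈ A, 0 < a)
    (hB : ∀ b ∈ B, 0 < b) {d : ℝ} (hd : d ≠ 0) :
    (B.card : ℝ) * ((B ×ˢ A ×ˢ A).filter fun z => z.1 / z.2.2 - z.1 / z.2.1 = d).card ≤
      3 * ((B.card : ℝ) ^ 2 * (B / A).card * A.card) ^ ((2 : ℝ) / 3) +
        2 * ((B / A).card * A.card) := by
  classical
  -- For every auxiliary b' in B, write 1/c' = (b'/c')(1/b'). The equation then says that (1/b',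
  -- d/b) lies on the line of slope b'/c' and intercept -1/c, so each solution yields |B|
  -- incidences.
  have key := grid_incidences_le (B.image fun b => b⁻¹) (B.image fun b => d / b) ((B / A) ×ˢ A)
    (fun i => i.1) (fun i => -i.2⁻¹) (fun i hi => by
      rw [Finset.mem_product] at hi
      obtain ⟨b, hb, a, ha, h⟩ := Finset.mem_div.1 hi.1
      rw [← h]
      exact (div_pos (hB b hb) (hA a ha)).ne') (by
      rintro ⟨x, y⟩ _ ⟨x', y'⟩ _ h
      simpa using h)
  have hc1 : (B.image fun b => b⁻¹).card = B.card :=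
    Finset.card_image_of_injective _ inv_injective
  have hc2 : (B.image fun b => d / b).card = B.card :=
    Finset.card_image_of_injective _ fun x y h => by
      simpa [div_eq_mul_inv, hd] using h
  rw [hc1, hc2, Finset.card_product] at key
  have hle : B.card * ((B ×ˢ A ×ˢ A).filter fun z => z.1 / z.2.2 - z.1 / z.2.1 = d).card ≤
      ∑ i ∈ (B / A) ×ˢ A, ((B.image fun b => b⁻¹).filter fun x =>
        i.1 * x + -i.2⁻¹ ∈ B.image fun b => d / b).card := by
    rw [← Finset.card_product, ← Finset.card_sigma]
    refine Finset.card_le_card_of_injOn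
      (fun z => ⟨(z.1 / z.2.2.2, z.2.2.1), z.1⁻¹⟩) ?_ ?_
    · rintro ⟨b', b, c, c'⟩ hz
      simp only [Finset.mem_coe, Finset.mem_product, Finset.mem_filter] at hz
      obtain ⟨hb', ⟨hb, hc, hc'⟩, h⟩ := hz
      simp only [Finset.mem_coe, Finset.mem_sigma, Finset.mem_product, Finset.mem_filter,
        Finset.mem_image]
      refine ⟨⟨Finset.div_mem_div hb' hc', hc⟩, ⟨b', hb', rfl⟩, b, hb, ?_⟩
      have h1 := (hB b hb).ne'
      have h2 := (hB b' hb').ne'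
      have h3 := (hA c hc).ne'
      have h4 := (hA c' hc').ne'
      rw [← h]
      field_simp
      ring
    · rintro ⟨b', b, c, c'⟩ hz ⟨e', e, f, f'⟩ hw hzw
      simp only [Finset.mem_coe, Finset.mem_product, Finset.mem_filter] at hz hw
      simp only [Sigma.mk.injEq, Prod.mk.injEq, heq_eq_eq, inv_inj] at hzw
      obtain ⟨⟨h1, rfl⟩, rfl⟩ := hzw
      have hb' := (hB b' hz.1).ne'
      have h2 : c' = f' := by
        have := hA c' hz.2.1.2.2
        have := hA f' hw.2.1.2.2
        field_simp at h1
        exact h1.symm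
      subst h2
      have h3 : (b - e) * (1 / c' - 1 / c) = 0 := by
        have e1 := hz.2.2
        have e2 := hw.2.2
        have : b / c' - b / c = e / c' - e / c := e1.trans e2.symm
        linear_combination this
      have h4 : (1 / c' - 1 / c) ≠ 0 := by
        intro h
        apply hd
        have e1 := hz.2.2
        rw [← e1]
        linear_combination b * h
      have h5 : b = e := by
        have := (mul_eq_zero.1 h3).resolve_right h4
        linarith
      rw [h5]
  have hle' : (B.card : ℝ) *
      ((B ×ˢ A ×ˢ A).filter fun z => z.1 / z.2.2 - z.1 / z.2.1 = d).card ≤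
      ((∑ i ∈ (B / A) ×ˢ A, ((B.image fun b => b⁻¹).filter fun x =>
        i.1 * x + -i.2⁻¹ ∈ B.image fun b => d / b).card : ℕ) : ℝ) := by exact_mod_cast hle
  refine hle'.trans (key.trans (le_of_eq ?_))
  push_cast
  ring_nf

/-- A set containing all `z + b / c` either is large in terms of the number of `z`, or exceeds
the size of `A` by a power of `B`. -/
theorem card_add_div_growth {A B Z U : Finset ℝ} (hA : ∀ a ∈ A, 0 < a) (hB : ∀ b ∈ B, 0 < b)
    (hAne : A.Nonempty) (hBne : B.Nonempty) (hZne : Z.Nonempty)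
    (hU : ∀ z ∈ Z, ∀ b ∈ B, ∀ c ∈ A, z + b / c ∈ U) :
    (A.card : ℝ) * Z.card ≤ 2 * U.card ∨
      (A.card : ℝ) ^ 4 * B.card ^ 2 ≤ 1728 * (U.card : ℝ) ^ 5 := by
  classical
  have hWU : (B / A).card ≤ U.card := by
    obtain ⟨z, hz⟩ := hZne
    refine Finset.card_le_card_of_injOn (fun x => z + x) ?_ (add_right_injective z).injOn
    intro x hx
    obtain ⟨b, hb, c, hc, rfl⟩ := Finset.mem_div.1 (Finset.mem_coe.1 hx)
    exact hU z hz b hb c hc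
  have hAU : A.card ≤ U.card := by
    refine le_trans ?_ hWU
    obtain ⟨b, hb⟩ := hBne
    refine Finset.card_le_card_of_injOn (fun x => b / x) ?_ ?_
    · intro x hx
      exact Finset.div_mem_div hb hx
    · intro x hx y hy h
      have := hB b hb
      have := hA x hx
      have := hA y hy
      simp only at h
      field_simp at h
      exact h.symm
  have hN0 : (0 : ℝ) < A.card := by exact_mod_cast hAne.card_pos
  have hτ0 : (0 : ℝ) < B.card := by exact_mod_cast hBne.card_pos
  have hk0 : (0 : ℝ) < Z.card := by exact_mod_cast hZne.card_pos
  have hNn : (A.card : ℝ) ≤ U.card := by exact_mod_cast hAU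
  have hwn : ((B / A).card : ℝ) ≤ U.card := by exact_mod_cast hWU
  set N : ℝ := (A.card : ℝ) with hN
  set τ : ℝ := (B.card : ℝ) with hτ
  set k : ℝ := (Z.card : ℝ) with hk
  set n : ℝ := (U.card : ℝ) with hn
  set D : ℝ := 3 * (τ ^ 2 * n * N) ^ ((2 : ℝ) / 3) + 2 * (n * N) with hD
  have hR : ∀ d : ℝ, d ≠ 0 →
      τ * ((B ×ˢ A ×ˢ A).filter fun z => z.1 / z.2.2 - z.1 / z.2.1 = d).card ≤ D := by
    intro d hd
    refine (card_mul_card_dilated_differences_le hA hB hd).trans ?_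
    rw [hD]
    gcongr
  set E : ℝ → Finset ((ℝ × ℝ) × (ℝ × ℝ)) := fun b => ((Z ×ˢ A) ×ˢ (Z ×ˢ A)).filter fun q =>
    q.1.1 + b / q.1.2 = q.2.1 + b / q.2.2 with hE
  -- Cauchy–Schwarz for (z, c) ↦ z + b/c with b fixed. Below, coincidences with z = z' force c = c';
  -- the others represent z - z' ≠ 0 as b/c' - b/c, which `hR` controls after summing over b.
  have hcs : ∀ b ∈ B, (k * N) ^ 2 ≤ n * (E b).card := by
    intro b hb
    have := card_sq_le_card_mul_card_coincidences (Z ×ˢ A) (fun q : ℝ × ℝ => q.1 + b / q.2) U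
      (fun q hq => hU _ (Finset.mem_product.1 hq).1 b hb _ (Finset.mem_product.1 hq).2)
    rw [Finset.card_product] at this
    have h : ((Z.card : ℝ) * A.card) ^ 2 ≤ U.card * (E b).card := by exact_mod_cast this
    exact h
  have hEsum : ∑ b ∈ B, (E b).card ≤ B.card * (Z.card * A.card) +
      ∑ q ∈ Z.offDiag, ((B ×ˢ A ×ˢ A).filter fun z => z.1 / z.2.2 - z.1 / z.2.1 =
        q.1 - q.2).card := by
    rw [← Finset.card_product Z A, ← Finset.card_product B, ← Finset.card_sigma,
      ← Finset.card_sigma, ← Finset.card_disjSum]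
    refine Finset.card_le_card_of_injOn (fun z => if z.2.1.1 = z.2.2.1
      then Sum.inl (z.1, (z.2.1.1, z.2.1.2))
      else Sum.inr ⟨(z.2.1.1, z.2.2.1), (z.1, (z.2.1.2, z.2.2.2))⟩) ?_ ?_
    · rintro ⟨b, ⟨z, c⟩, z', c'⟩ h
      simp only [Finset.mem_coe, Finset.mem_sigma, hE, Finset.mem_filter, Finset.mem_product] at h
      obtain ⟨hb, ⟨⟨hz, hc⟩, hz', hc'⟩, h⟩ := h
      by_cases hzz : z = z'
      · simp [hzz, hb, hz', hc]
      · simp only [hzz, if_false, Finset.mem_coe, Finset.inr_mem_disjSum, Finset.mem_sigma,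
          Finset.mem_offDiag, Finset.mem_filter, Finset.mem_product]
        refine ⟨⟨hz, hz', hzz⟩, ⟨hb, hc, hc'⟩, by linarith⟩
    · rintro ⟨b, ⟨z, c⟩, z', c'⟩ h ⟨b₁, ⟨z₁, c₁⟩, z₁', c₁'⟩ h₁ heq
      simp only [Finset.mem_coe, Finset.mem_sigma, hE, Finset.mem_filter, Finset.mem_product] at h h₁
      by_cases hzz : z = z'
      · by_cases hzz₁ : z₁ = z₁'
        · simp only [hzz, hzz₁, if_true, Sum.inl.injEq, Prod.mk.injEq] at heq
          obtain ⟨rfl, hzz', hcc⟩ := heq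
          have aux : ∀ x y u v : ℝ, x ∈ A → y ∈ A → u = v → u + b / x = v + b / y → x = y := by
            intro x y u v hx hy huv hxy
            have hb := hB b h.1
            have h1 := hA x hx
            have h2 := hA y hy
            rw [huv] at hxy
            have := add_left_cancel hxy
            field_simp at this
            exact this.symm
          have e1 := aux c c' z z' h.2.1.1.2 h.2.1.2.2 hzz h.2.2
          have e2 := aux c₁ c₁' z₁ z₁' h₁.2.1.1.2 h₁.2.1.2.2 hzz₁ h₁.2.2
          simp [hzz, hzz₁, hzz', ← e1, ← e2, hcc]
        · simp [hzz, hzz₁] at heq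
      · by_cases hzz₁ : z₁ = z₁'
        · simp [hzz, hzz₁] at heq
        · simp only [hzz, hzz₁, if_false, Sum.inr.injEq, Sigma.mk.injEq, Prod.mk.injEq,
            heq_eq_eq] at heq
          obtain ⟨⟨rfl, rfl⟩, rfl, rfl, rfl⟩ := heq
          rfl
  have hoff : τ * ((∑ q ∈ Z.offDiag, ((B ×ˢ A ×ˢ A).filter fun z => z.1 / z.2.2 - z.1 / z.2.1 =
        q.1 - q.2).card : ℕ) : ℝ) ≤ k ^ 2 * D := by
    push_cast
    rw [Finset.mul_sum]
    have hD0 : 0 ≤ D := by positivity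
    calc _ ≤ ∑ q ∈ Z.offDiag, D := Finset.sum_le_sum fun q hq =>
          hR _ (sub_ne_zero.2 (Finset.mem_offDiag.1 hq).2.2)
      _ = (Z.offDiag.card : ℝ) * D := by rw [Finset.sum_const, nsmul_eq_mul]
      _ ≤ k ^ 2 * D := by
        gcongr
        rw [Finset.offDiag_card, sq, hk]
        exact_mod_cast Nat.sub_le _ _
  have hmain : τ ^ 2 * (k * N) ^ 2 ≤ n * (τ ^ 2 * (k * N) + k ^ 2 * D) := by
    have h1 : τ * (k * N) ^ 2 ≤ n * ((∑ b ∈ B, (E b).card : ℕ) : ℝ) := by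
      push_cast
      rw [Finset.mul_sum, hτ, ← nsmul_eq_mul]
      exact Finset.card_nsmul_le_sum _ _ _ hcs
    set S := ∑ q ∈ Z.offDiag, ((B ×ˢ A ×ˢ A).filter fun z => z.1 / z.2.2 - z.1 / z.2.1 =
        q.1 - q.2).card with hS
    have h2 : ((∑ b ∈ B, (E b).card : ℕ) : ℝ) ≤ B.card * ((Z.card : ℝ) * A.card) + S := by
      exact_mod_cast hEsum
    have hn0 : 0 ≤ n := by positivity
    calc τ ^ 2 * (k * N) ^ 2 = τ * (τ * (k * N) ^ 2) := by ring
      _ ≤ τ * (n * (τ * (k * N) + S)) :=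
        mul_le_mul_of_nonneg_left (h1.trans (mul_le_mul_of_nonneg_left h2 hn0)) hτ0.le
      _ = n * (τ ^ 2 * (k * N) + τ * S) := by ring
      _ ≤ _ := mul_le_mul_of_nonneg_left (add_le_add_right hoff _) hn0
  have hdiv : τ ^ 2 * k * N ^ 2 ≤ n * (τ ^ 2 * N + k * D) := by
    have : k * (τ ^ 2 * k * N ^ 2) ≤ k * (n * (τ ^ 2 * N + k * D)) := by
      calc _ = τ ^ 2 * (k * N) ^ 2 := by ring
        _ ≤ _ := hmain
        _ = _ := by ring
    exact le_of_mul_le_mul_left this hk0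
  by_cases hcase : N * k ≤ 2 * n
  · exact Or.inl hcase
  right
  push Not at hcase
  -- Since Nk > 2n, the diagonal term is less than half of the left side and can be absorbed.
  have h1 : τ ^ 2 * N ^ 2 ≤ 2 * n * D := by
    have h2 : n * (τ ^ 2 * N) ≤ τ ^ 2 * N * (N * k / 2) := by
      have : 0 < τ ^ 2 * N := by positivity
      nlinarith
    have : k * (τ ^ 2 * N ^ 2) ≤ k * (2 * n * D) := by nlinarith
    exact le_of_mul_le_mul_left this hk0
  have hn0 : 0 < n := hN0.trans_le hNn
  obtain ⟨y, hy0, hy3, hy2⟩ := exists_cube_root (show 0 ≤ τ ^ 2 * n * N by positivity)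
  rw [hD, hy2] at h1
  -- Either the main term of `D` dominates, or its linear term does; in the latter case τ²N ≤ 8n²,
  -- and N ≤ n finishes.
  by_cases hc : τ ^ 2 * N ^ 2 ≤ 12 * n * y ^ 2
  · have h3 : (τ ^ 2 * N ^ 2) ^ 3 ≤ (12 * n * y ^ 2) ^ 3 := by gcongr
    have h4 : (12 * n * y ^ 2) ^ 3 = 1728 * n ^ 3 * (τ ^ 2 * n * N) ^ 2 := by
      rw [← hy3]
      ring
    rw [h4] at h3
    have h5 : (τ ^ 4 * N ^ 2) * (N ^ 4 * τ ^ 2) ≤ (τ ^ 4 * N ^ 2) * (1728 * n ^ 5) := by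
      calc _ = (τ ^ 2 * N ^ 2) ^ 3 := by ring
        _ ≤ _ := h3
        _ = _ := by ring
    exact le_of_mul_le_mul_left h5 (by positivity)
  · push Not at hc
    have h3 : N * (τ ^ 2 * N) ≤ N * (8 * n ^ 2) := by nlinarith
    have h4 : τ ^ 2 * N ≤ 8 * n ^ 2 := le_of_mul_le_mul_left h3 hN0
    have h5 : N ^ 3 ≤ n ^ 3 := by gcongr
    calc N ^ 4 * τ ^ 2 = (τ ^ 2 * N) * N ^ 3 := by ring
      _ ≤ (8 * n ^ 2) * n ^ 3 := by gcongr
      _ ≤ 1728 * n ^ 5 := by nlinarith [pow_pos hn0 5]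

/-! ### Lines in rich directions -/

theorem pos_of_mem_div {A : Finset ℝ} (hA : ∀ a ∈ A, 0 < a) {l : ℝ} (hl : l ∈ A / A) : 0 < l := by
  obtain ⟨a, ha, b, hb, rfl⟩ := Finset.mem_div.1 hl
  exact div_pos (hA a ha) (hA b hb)

/-- The abscissae of the grid points of `A × A` on the line of slope `ℓ.1` and intercept `ℓ.2`. -/
noncomputable def gridLine (A : Finset ℝ) (ℓ : ℝ × ℝ) : Finset ℝ :=
  A.filter fun x => ℓ.1 * x + ℓ.2 ∈ A

theorem mem_gridLine {A : Finset ℝ} {ℓ : ℝ × ℝ} {x : ℝ} :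
    x ∈ gridLine A ℓ ↔ x ∈ A ∧ ℓ.1 * x + ℓ.2 ∈ A :=
  Finset.mem_filter

/-- The translation by (b/c, lb/c), where l is the slope of the line, preserves the line, and both
coordinates of this vector lie in A/A. -/
theorem add_div_mem_gridLine {A : Finset ℝ} {ℓ : ℝ × ℝ} {z b c : ℝ} (hz : z ∈ gridLine A ℓ)
    (hb : b ∈ slopeFiber A ℓ.1) (hc : c ∈ A) : z + b / c ∈ gridLine (A / A + A) ℓ := by
  rw [mem_gridLine] at hz ⊢
  rw [mem_slopeFiber] at hb
  constructor
  · rw [add_comm z]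
    exact Finset.add_mem_add (Finset.div_mem_div hb.1 hc) hz.1
  · have : ℓ.1 * (z + b / c) + ℓ.2 = ℓ.1 * b / c + (ℓ.1 * z + ℓ.2) := by ring
    rw [this]
    exact Finset.add_mem_add (Finset.div_mem_div hb.2 hc) hz.2

theorem card_le_card_gridLine {A : Finset ℝ} (hA : ∀ a ∈ A, 0 < a) {ℓ : ℝ × ℝ}
    (hZ : (gridLine A ℓ).Nonempty) (hB : (slopeFiber A ℓ.1).Nonempty) :
    A.card ≤ (gridLine (A / A + A) ℓ).card := by
  obtain ⟨z, hz⟩ := hZ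
  obtain ⟨b, hb⟩ := hB
  refine Finset.card_le_card_of_injOn (fun c => z + b / c)
    (fun c hc => add_div_mem_gridLine hz hb hc) ?_
  intro x hx y hy h
  have h0 := hA b (mem_slopeFiber.1 hb).1
  have h1 := hA x hx
  have h2 := hA y hy
  have := add_left_cancel h
  field_simp at this
  exact this.symm

/-- `card_add_div_growth` is applied along the line. The condition on `κ` makes its second
alternative as strong as the first: (Nκ)^5 ≤ N^4τ² ≤ 1728 n^5 ≤ (5n)^5. The value `κ = 1` falls back
on the bound by fixing one z and one b. -/
theorem mul_le_card_gridLine {A : Finset ℝ} (hA : ∀ a ∈ A, 0 < a) {ℓ : ℝ × ℝ}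
    (hZ : (gridLine A ℓ).Nonempty) {τ : ℕ} (hτ : 1 ≤ τ) (hB : τ ≤ (slopeFiber A ℓ.1).card)
    {κ : ℝ} (hκτ : κ = 1 ∨ κ ^ 5 * A.card ≤ (τ : ℝ) ^ 2) (hκ : κ ≤ (gridLine A ℓ).card) :
    (A.card : ℝ) * κ / 5 ≤ (gridLine (A / A + A) ℓ).card := by
  have hBne : (slopeFiber A ℓ.1).Nonempty := Finset.card_pos.1 (lt_of_lt_of_le hτ hB)
  have hAne : A.Nonempty := hZ.mono (Finset.filter_subset _ _)
  have hNn : (A.card : ℝ) ≤ (gridLine (A / A + A) ℓ).card :=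
    Nat.cast_le.2 (card_le_card_gridLine hA hZ hBne)
  have hτB : (τ : ℝ) ≤ (slopeFiber A ℓ.1).card := Nat.cast_le.2 hB
  have hN0 : (0 : ℝ) ≤ A.card := Nat.cast_nonneg _
  have key := card_add_div_growth (U := gridLine (A / A + A) ℓ) hA
    (fun b hb => hA b (mem_slopeFiber.1 hb).1) hAne hBne hZ
    (fun z hz b hb c hc => add_div_mem_gridLine hz hb hc)
  generalize ((gridLine (A / A + A) ℓ).card : ℝ) = n at *
  generalize ((gridLine A ℓ).card : ℝ) = k at *
  generalize ((slopeFiber A ℓ.1).card : ℝ) = B at *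
  generalize (A.card : ℝ) = N at *
  rcases hκτ with h | h
  · rw [h]
    linarith
  rcases key with h1 | h1
  · have : N * κ ≤ N * k := by gcongr
    linarith
  · have h2 : (N * κ) ^ 5 ≤ (5 * n) ^ 5 := by
      calc (N * κ) ^ 5 = N ^ 4 * (κ ^ 5 * N) := by ring
        _ ≤ N ^ 4 * (τ : ℝ) ^ 2 := by gcongr
        _ ≤ N ^ 4 * B ^ 2 := by gcongr
        _ ≤ 1728 * n ^ 5 := h1
        _ ≤ (5 * n) ^ 5 := by
          have : 0 ≤ n ^ 5 := pow_nonneg (hN0.trans hNn) 5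
          linarith [mul_pow 5 n 5]
    have h3 := le_of_pow_le_pow_left₀ (by norm_num) (by linarith) h2
    linarith

/-- Lines through points of `A × A` in rich directions: those with many points of `A × A` carry
less than half of all incidences, and the others are very rich for `A / A + A`. -/
theorem card_richSlopes_mul_le {A : Finset ℝ} (hA : ∀ a ∈ A, 0 < a) (hN : 20 ≤ A.card) {τ : ℕ}
    (hτ : 1 ≤ τ) {κ k₁ : ℝ} (hκ : 1 ≤ κ) (hκτ : κ = 1 ∨ κ ^ 5 * A.card ≤ (τ : ℝ) ^ 2)
    (hk₁ : 4 ≤ k₁) (hk₁s : 432 * (A.card : ℝ) ^ 2 ≤ k₁ ^ 2 * (richSlopes A τ).card) :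
    ((richSlopes A τ).card : ℝ) * (A.card : ℝ) ^ 5 * κ ^ 3 ≤
      432 * ((A / A + A).card : ℝ) ^ 4 * (κ ^ 4 + 125 * k₁) := by
  classical
  set S := richSlopes A τ with hS
  set J : Finset (ℝ × ℝ) := (S ×ˢ A ×ˢ A).image fun q => (q.1, q.2.2 - q.1 * q.2.1) with hJ
  have hJS : ∀ ℓ ∈ J, ℓ.1 ∈ S ∧ (gridLine A ℓ).Nonempty := by
    intro ℓ hℓ
    obtain ⟨⟨l, x, y⟩, hq, rfl⟩ := Finset.mem_image.1 hℓ
    simp only [Finset.mem_product] at hq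
    refine ⟨hq.1, x, mem_gridLine.2 ⟨hq.2.1, ?_⟩⟩
    simpa using hq.2.2
  have hslope : ∀ ℓ ∈ J, ℓ.1 ≠ 0 := fun ℓ hℓ =>
    (pos_of_mem_div hA (Finset.mem_filter.1 (hJS ℓ hℓ).1).1).ne'
  have hBτ : ∀ ℓ ∈ J, τ ≤ (slopeFiber A ℓ.1).card := fun ℓ hℓ =>
    (Finset.mem_filter.1 (hJS ℓ hℓ).1).2
  have hBne : ∀ ℓ ∈ J, (slopeFiber A ℓ.1).Nonempty := fun ℓ hℓ =>
    Finset.card_pos.1 (lt_of_lt_of_le hτ (hBτ ℓ hℓ))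
  have hinj : ∀ J' : Finset (ℝ × ℝ), Set.InjOn (fun ℓ : ℝ × ℝ => (ℓ.1, ℓ.2)) J' :=
    fun J' => Function.injective_id.injOn
  set k : ℝ × ℝ → ℝ := fun ℓ => ((gridLine A ℓ).card : ℝ) with hk
  -- Through each point of A × A there passes one line of each slope in `S`.
  have htotal : (S.card : ℝ) * (A.card : ℝ) ^ 2 ≤ ∑ ℓ ∈ J, k ℓ := by
    have : S.card * (A.card * A.card) ≤ ∑ ℓ ∈ J, (gridLine A ℓ).card := by
      rw [← Finset.card_product, ← Finset.card_product, ← Finset.card_sigma]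
      refine Finset.card_le_card_of_injOn
        (fun q => ⟨(q.1, q.2.2 - q.1 * q.2.1), q.2.1⟩) ?_ ?_
      · rintro ⟨l, x, y⟩ hq
        simp only [Finset.mem_coe, Finset.mem_product] at hq
        simp only [Finset.mem_coe, Finset.mem_sigma, mem_gridLine]
        refine ⟨Finset.mem_image.2 ⟨(l, x, y), by simp [hq], rfl⟩, hq.2.1, ?_⟩
        simpa using hq.2.2
      · rintro ⟨l, x, y⟩ _ ⟨l', x', y'⟩ _ h
        simp only [Sigma.mk.injEq, Prod.mk.injEq, heq_eq_eq] at h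
        obtain ⟨⟨rfl, h⟩, rfl⟩ := h
        simp only [sub_left_inj] at h
        rw [h]
    have h' : (S.card : ℝ) * ((A.card : ℝ) * A.card) ≤ ((∑ ℓ ∈ J, (gridLine A ℓ).card : ℕ) : ℝ) := by
      exact_mod_cast this
    rw [sq]
    simpa [hk] using h'
  set N : ℝ := (A.card : ℝ) with hNdef
  set s : ℝ := (S.card : ℝ) with hs
  set σ : ℝ := ((A / A + A).card : ℝ) with hσ
  have hN20 : (20 : ℝ) ≤ N := by
    have : ((20 : ℕ) : ℝ) ≤ (A.card : ℝ) := by exact_mod_cast hN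
    exact le_trans (by norm_num) this
  have hN0 : 0 < N := by linarith
  have hAne : A.Nonempty := Finset.card_pos.1 (by omega)
  -- lines with many points of `A × A`
  have hbig : ∑ ℓ ∈ J.filter (fun ℓ => k₁ < k ℓ), k ℓ ≤ s * N ^ 2 / 2 := by
    set L := J.filter (fun ℓ => k₁ < k ℓ) with hL
    have hLJ : ∀ ℓ ∈ L, ℓ ∈ J := fun ℓ hℓ => (Finset.mem_filter.1 hℓ).1
    have h1 : (∑ ℓ ∈ L, k ℓ) * k₁ ^ 2 ≤ 216 * (N * N) ^ 2 :=
      rich_incidences_mul_le A A L (fun ℓ => ℓ.1) (fun ℓ => ℓ.2)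
        (fun ℓ hℓ => hslope ℓ (hLJ ℓ hℓ)) (hinj L) hk₁ fun ℓ hℓ => (Finset.mem_filter.1 hℓ).2.le
    have h7 : k₁ ^ 2 * (∑ ℓ ∈ L, k ℓ) ≤ k₁ ^ 2 * (s * N ^ 2 / 2) := by
      -- The threshold `k₁` was required to be large enough for exactly this factor one half.
      have : 432 * N ^ 2 * N ^ 2 ≤ k₁ ^ 2 * s * N ^ 2 := by gcongr
      linarith
    exact le_of_mul_le_mul_left h7 (by positivity)
  -- lines with few points of `A × A`
  have hsmall : (∑ ℓ ∈ J.filter (fun ℓ => k ℓ < κ), k ℓ) * N ^ 3 ≤ 216 * σ ^ 4 * κ := by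
    set L := J.filter (fun ℓ => k ℓ < κ) with hL
    have hLJ : ∀ ℓ ∈ L, ℓ ∈ J := fun ℓ hℓ => (Finset.mem_filter.1 hℓ).1
    have h1 := card_rich_lines_mul_le (A / A + A) (A / A + A) L (fun ℓ => ℓ.1) (fun ℓ => ℓ.2)
      (fun ℓ hℓ => hslope ℓ (hLJ ℓ hℓ)) (hinj L) (n := N) (by linarith) (fun ℓ hℓ => by
        have := card_le_card_gridLine hA (hJS ℓ (hLJ ℓ hℓ)).2 (hBne ℓ (hLJ ℓ hℓ))
        exact Nat.cast_le.2 this)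
    have h2 : ∑ ℓ ∈ L, k ℓ ≤ L.card * κ := by
      rw [← nsmul_eq_mul]
      exact Finset.sum_le_card_nsmul _ _ _ fun ℓ hℓ => (Finset.mem_filter.1 hℓ).2.le
    calc _ ≤ (L.card * κ) * N ^ 3 := by gcongr
      _ = (L.card * N ^ 3) * κ := by ring
      _ ≤ (216 * (σ * σ) ^ 2) * κ := by gcongr
      _ = _ := by ring
  -- the remaining lines
  have hmid : (∑ ℓ ∈ J.filter (fun ℓ => κ ≤ k ℓ ∧ k ℓ ≤ k₁), k ℓ) * (N ^ 3 * κ ^ 3) ≤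
      125 * 216 * σ ^ 4 * k₁ := by
    set L := J.filter (fun ℓ => κ ≤ k ℓ ∧ k ℓ ≤ k₁) with hL
    have hLJ : ∀ ℓ ∈ L, ℓ ∈ J := fun ℓ hℓ => (Finset.mem_filter.1 hℓ).1
    -- The richness Nκ/5 is at least 4 because N ≥ 20 and κ ≥ 1.
    have h1 := card_rich_lines_mul_le (A / A + A) (A / A + A) L (fun ℓ => ℓ.1) (fun ℓ => ℓ.2)
      (fun ℓ hℓ => hslope ℓ (hLJ ℓ hℓ)) (hinj L) (n := N * κ / 5) (by nlinarith) (fun ℓ hℓ => by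
        exact mul_le_card_gridLine hA (hJS ℓ (hLJ ℓ hℓ)).2 hτ (hBτ ℓ (hLJ ℓ hℓ)) hκτ
          (Finset.mem_filter.1 hℓ).2.1)
    have h2 : ∑ ℓ ∈ L, k ℓ ≤ L.card * k₁ := by
      rw [← nsmul_eq_mul]
      exact Finset.sum_le_card_nsmul _ _ _ fun ℓ hℓ => (Finset.mem_filter.1 hℓ).2.2
    calc _ ≤ (L.card * k₁) * (N ^ 3 * κ ^ 3) := by gcongr
      _ = 125 * k₁ * (L.card * (N * κ / 5) ^ 3) := by ring
      _ ≤ 125 * k₁ * (216 * (σ * σ) ^ 2) := by gcongr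
      _ = _ := by ring
  have hcover : ∑ ℓ ∈ J, k ℓ ≤ ∑ ℓ ∈ J.filter (fun ℓ => k₁ < k ℓ), k ℓ +
      (∑ ℓ ∈ J.filter (fun ℓ => k ℓ < κ), k ℓ +
        ∑ ℓ ∈ J.filter (fun ℓ => κ ≤ k ℓ ∧ k ℓ ≤ k₁), k ℓ) := by
    simp only [Finset.sum_filter]
    rw [← Finset.sum_add_distrib, ← Finset.sum_add_distrib]
    refine Finset.sum_le_sum fun ℓ _ => ?_
    have : 0 ≤ k ℓ := Nat.cast_nonneg _
    by_cases h1 : k₁ < k ℓ <;> by_cases h2 : k ℓ < κ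
    · simp [h1, h2, h2.not_ge, this]
    · simp [h1, h2, h1.not_ge]
    · simp [h1, h2, h2.not_ge]
    · simp [h1, h2, not_lt.1 h1, not_lt.1 h2]
  have hhalf : s * N ^ 2 / 2 ≤ ∑ ℓ ∈ J.filter (fun ℓ => k ℓ < κ), k ℓ +
        ∑ ℓ ∈ J.filter (fun ℓ => κ ≤ k ℓ ∧ k ℓ ≤ k₁), k ℓ := by linarith
  generalize (∑ ℓ ∈ J.filter (fun ℓ => k ℓ < κ), k ℓ) = I₁ at *
  generalize (∑ ℓ ∈ J.filter (fun ℓ => κ ≤ k ℓ ∧ k ℓ ≤ k₁), k ℓ) = I₂ at *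
  calc s * N ^ 5 * κ ^ 3 = 2 * ((s * N ^ 2 / 2) * (N ^ 3 * κ ^ 3)) := by ring
    _ ≤ 2 * ((I₁ + I₂) * (N ^ 3 * κ ^ 3)) := by gcongr
    _ = 2 * ((I₁ * N ^ 3) * κ ^ 3 + I₂ * (N ^ 3 * κ ^ 3)) := by ring
    _ ≤ 2 * ((216 * σ ^ 4 * κ) * κ ^ 3 + 125 * 216 * σ ^ 4 * k₁) := by gcongr
    _ = _ := by ring

/-! ### Counting coincidences between sums -/

/-- The grid incidence bound for a set of objects that inject into the incidences. -/
theorem card_le_of_incidences {α ι : Type*} (T : Finset α) (P Q : Finset ℝ) (J : Finset ι)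
    (m k : ι → ℝ) (hm : ∀ i ∈ J, m i ≠ 0) (hinj : Set.InjOn (fun i => (m i, k i)) J)
    (φ : α → ι) (x : α → ℝ)
    (hT : ∀ t ∈ T, φ t ∈ J ∧ x t ∈ P ∧ m (φ t) * x t + k (φ t) ∈ Q)
    (hTinj : ∀ t ∈ T, ∀ t' ∈ T, φ t = φ t' → x t = x t' → t = t') :
    (T.card : ℝ) ≤ 3 * ((P.card : ℝ) * Q.card * J.card) ^ ((2 : ℝ) / 3) + 2 * J.card := by
  classical
  refine le_trans ?_ (grid_incidences_le P Q J m k hm hinj)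
  rw [Nat.cast_le, ← Finset.card_sigma]
  refine Finset.card_le_card_of_injOn (fun t => ⟨φ t, x t⟩) ?_ ?_
  · intro t ht
    obtain ⟨h1, h2, h3⟩ := hT t ht
    simp only [Finset.mem_coe, Finset.mem_sigma, Finset.mem_filter]
    exact ⟨h1, h2, h3⟩
  · intro t ht t' ht' h
    simp only [Sigma.mk.injEq, heq_eq_eq] at h
    exact hTinj t ht t' ht' h.1 h.2

theorem card_image_inv_eq (A : Finset ℝ) : (A.image fun a => a⁻¹).card = A.card :=
  Finset.card_image_of_injective _ inv_injective

/-- Solutions of `α b / c + β x = γ x'`. -/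
theorem card_solutions_one_div_le {A B X X' : Finset ℝ}
    (hB : ∀ b ∈ B, 0 < b) {α β γ : ℝ} (hα : α ≠ 0) (hβ : β ≠ 0) (hγ : γ ≠ 0) :
    (((B ×ˢ A ×ˢ X ×ˢ X').filter fun z =>
        α * (z.1 / z.2.1) + β * z.2.2.1 = γ * z.2.2.2).card : ℝ) ≤
      3 * ((A.card : ℝ) * X'.card * (B.card * X.card)) ^ ((2 : ℝ) / 3) +
        2 * (B.card * X.card) := by
  classical
  -- The point (1/c, x') lies on the line of slope αb/γ and intercept βx/γ.
  have key := card_le_of_incidences ((B ×ˢ A ×ˢ X ×ˢ X').filter fun z =>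
        α * (z.1 / z.2.1) + β * z.2.2.1 = γ * z.2.2.2) (A.image fun a => a⁻¹) X' (B ×ˢ X)
    (fun i => α * i.1 / γ) (fun i => β * i.2 / γ) (fun i hi => by
      have := (hB _ (Finset.mem_product.1 hi).1).ne'
      positivity) (by
      rintro ⟨b, x⟩ _ ⟨b', x'⟩ _ h
      simp only [Prod.mk.injEq] at h
      obtain ⟨h1, h2⟩ := h
      field_simp at h1 h2
      rw [h1, h2])
    (fun z => (z.1, z.2.2.1)) (fun z => z.2.1⁻¹) (by
      rintro ⟨b, c, x, x'⟩ hz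
      simp only [Finset.mem_filter, Finset.mem_product] at hz
      obtain ⟨⟨hb, hc, hx, hx'⟩, h⟩ := hz
      refine ⟨Finset.mem_product.2 ⟨hb, hx⟩, Finset.mem_image_of_mem _ hc, ?_⟩
      have : α * b / γ * c⁻¹ + β * x / γ = x' := by
        have : α * b / γ * c⁻¹ + β * x / γ = (α * (b / c) + β * x) / γ := by ring
        rw [this, h]
        field_simp
      rw [this]
      exact hx') (by
      rintro ⟨b, c, x, x'⟩ hz ⟨b₁, c₁, x₁, x₁'⟩ hz₁ h1 h2
      simp only [Finset.mem_filter, Finset.mem_product] at hz hz₁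
      simp only [Prod.mk.injEq, inv_inj] at h1 h2
      obtain ⟨rfl, rfl⟩ := h1
      subst h2
      have : γ * x' = γ * x₁' := hz.2.symm.trans hz₁.2
      rw [mul_left_cancel₀ hγ this])
  rw [card_image_inv_eq, Finset.card_product] at key
  push_cast at key
  exact key

/-- Solutions of `b / c - b / c' = γ x`. -/
theorem card_solutions_two_div_le {A B X : Finset ℝ} (hA : ∀ a ∈ A, 0 < a)
    (hB : ∀ b ∈ B, 0 < b) {γ : ℝ} (hγ : γ ≠ 0) :
    (((B ×ˢ A ×ˢ A ×ˢ X).filter fun z =>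
        z.1 / z.2.1 - z.1 / z.2.2.1 = γ * z.2.2.2).card : ℝ) ≤
      3 * ((X.card : ℝ) * A.card * (B.card * A.card)) ^ ((2 : ℝ) / 3) +
        2 * (B.card * A.card) := by
  classical
  -- The point (x, 1/c) lies on the line of slope γ/b and intercept 1/c'.
  have key := card_le_of_incidences ((B ×ˢ A ×ˢ A ×ˢ X).filter fun z =>
        z.1 / z.2.1 - z.1 / z.2.2.1 = γ * z.2.2.2) X (A.image fun a => a⁻¹) (B ×ˢ A)
    (fun i => γ / i.1) (fun i => i.2⁻¹) (fun i hi => by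
      have := (hB _ (Finset.mem_product.1 hi).1).ne'
      positivity) (by
      rintro ⟨b, x⟩ hb ⟨b', x'⟩ hb' h
      simp only [Prod.mk.injEq, inv_inj] at h
      obtain ⟨h1, h2⟩ := h
      have e1 := hB _ (Finset.mem_product.1 (Finset.mem_coe.1 hb)).1
      have e2 := hB _ (Finset.mem_product.1 (Finset.mem_coe.1 hb')).1
      simp only at e1 e2
      field_simp at h1
      rw [h1, h2])
    (fun z => (z.1, z.2.2.1)) (fun z => z.2.2.2) (by
      rintro ⟨b, c, c', x⟩ hz
      simp only [Finset.mem_filter, Finset.mem_product] at hz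
      obtain ⟨⟨hb, hc, hc', hx⟩, h⟩ := hz
      refine ⟨Finset.mem_product.2 ⟨hb, hc'⟩, hx, Finset.mem_image.2 ⟨c, hc, ?_⟩⟩
      have h1 := (hB b hb).ne'
      have : γ / b * x = (γ * x) / b := by ring
      rw [this, ← h]
      field_simp
      ring) (by
      rintro ⟨b, c, c', x⟩ hz ⟨b₁, c₁, c₁', x₁⟩ hz₁ h1 h2
      simp only [Finset.mem_filter, Finset.mem_product] at hz hz₁
      simp only [Prod.mk.injEq] at h1 h2
      obtain ⟨rfl, rfl⟩ := h1
      subst h2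
      have hb := hB b hz.1.1
      have e1 := hA c hz.1.2.1
      have e2 := hA c₁ hz₁.1.2.1
      have : b / c = b / c₁ := by linarith [hz.2, hz₁.2]
      field_simp at this
      rw [this])
  rw [card_image_inv_eq, Finset.card_product] at key
  push_cast at key
  exact key

/-- The coincidences `b / c + x = b₃ / c' + x'`, `l₁ b / c + l₂ x = l₃ b₃ / c' + l₄ x'` with
`l₃ ≠ l₁` or `l₄ ≠ l₂`, parametrized by three of the variables and the slopes. -/
noncomputable def coincidenceCost (A : Finset ℝ) (X : ℝ → Finset ℝ) (Λ₁ Λ₂ : Finset ℝ)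
    (l b : ℝ) : ℕ :=
  ∑ q ∈ Λ₂ ×ˢ Λ₂ ×ˢ Λ₁.erase l, ((A ×ˢ X q.1 ×ˢ X q.2.1).filter fun z =>
      (l - q.2.2) * (b / z.1) + (q.1 - q.2.2) * z.2.1 = (q.2.1 - q.2.2) * z.2.2).card +
    ∑ q ∈ Λ₂.offDiag, ((A ×ˢ A ×ˢ X q.1).filter fun z =>
      b / z.1 - b / z.2.1 = (q.1 - q.2) / (q.2 - l) * z.2.2).card

theorem card_filter_product_eq_sum {α β : Type*} (B : Finset α) (Y : Finset β)
    (p : α → β → Prop) [∀ a b, Decidable (p a b)] :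
    ((B ×ˢ Y).filter fun z => p z.1 z.2).card = ∑ b ∈ B, (Y.filter (p b)).card := by
  rw [Finset.card_filter, Finset.sum_product]
  exact Finset.sum_congr rfl fun b _ => (Finset.card_filter _ _).symm

/-- Some `b` among the `τ` admissible ones produces few coincidences. -/
theorem exists_coincidenceCost_le {A : Finset ℝ} (hA : ∀ a ∈ A, 0 < a) {X : ℝ → Finset ℝ}
    {Λ₁ Λ₂ : Finset ℝ} (hdisj : Disjoint Λ₁ Λ₂) {M τ : ℕ} (hτ : 1 ≤ τ) (h₁ : Λ₁.card = M)
    (h₂ : Λ₂.card = M) (hXA : ∀ l, X l ⊆ A) (hX : ∀ l ∈ Λ₁ ∪ Λ₂, (X l).card = τ)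
    {l : ℝ} (hl : l ∈ Λ₁) :
    ∃ b ∈ X l, (τ : ℝ) * coincidenceCost A X Λ₁ Λ₂ l b ≤
      (M : ℝ) ^ 3 * (3 * ((A.card : ℝ) * τ * (τ * τ)) ^ ((2 : ℝ) / 3) + 2 * (τ * τ)) +
      (M : ℝ) ^ 2 * (3 * ((τ : ℝ) * A.card * (τ * A.card)) ^ ((2 : ℝ) / 3) +
        2 * (τ * A.card)) := by
  classical
  have hX1 : (X l).card = τ := hX l (Finset.mem_union_left _ hl)
  have hX2 : ∀ l ∈ Λ₂, (X l).card = τ := fun l hl => hX l (Finset.mem_union_right _ hl)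
  have hpos : ∀ b ∈ X l, 0 < b := fun b hb => hA b (hXA l hb)
  have hne : ∀ {u v : ℝ}, u ∈ Λ₁ → v ∈ Λ₂ → v - u ≠ 0 := by
    intro u v hu hv h
    rw [sub_eq_zero] at h
    exact Finset.disjoint_left.1 hdisj hu (h ▸ hv)
  set D₁ : ℝ := 3 * ((A.card : ℝ) * τ * (τ * τ)) ^ ((2 : ℝ) / 3) + 2 * (τ * τ) with hD₁
  set D₂ : ℝ := 3 * ((τ : ℝ) * A.card * (τ * A.card)) ^ ((2 : ℝ) / 3) +
        2 * (τ * A.card) with hD₂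
  have hD₁0 : 0 ≤ D₁ := by positivity
  have hD₂0 : 0 ≤ D₂ := by positivity
  have hsum : ((∑ b ∈ X l, coincidenceCost A X Λ₁ Λ₂ l b : ℕ) : ℝ) ≤
      (M : ℝ) ^ 3 * D₁ + (M : ℝ) ^ 2 * D₂ := by
    unfold coincidenceCost
    rw [Finset.sum_add_distrib, Finset.sum_comm, Finset.sum_comm (s := X l) (t := Λ₂.offDiag)]
    rw [Nat.cast_add]
    refine add_le_add ?_ ?_
    · rw [Nat.cast_sum]
      have : ∀ q ∈ Λ₂ ×ˢ Λ₂ ×ˢ Λ₁.erase l, ((∑ b ∈ X l, ((A ×ˢ X q.1 ×ˢ X q.2.1).filter fun z =>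
          (l - q.2.2) * (b / z.1) + (q.1 - q.2.2) * z.2.1 =
            (q.2.1 - q.2.2) * z.2.2).card : ℕ) : ℝ) ≤ D₁ := by
        rintro ⟨u, v, w⟩ hq
        simp only [Finset.mem_product, Finset.mem_erase] at hq
        have := card_solutions_one_div_le (A := A) (X := X u) (X' := X v) hpos
          (sub_ne_zero.2 hq.2.2.1.symm) (hne hq.2.2.2 hq.1) (hne hq.2.2.2 hq.2.1)
        rw [card_filter_product_eq_sum (X l) (A ×ˢ X u ×ˢ X v) (fun b z =>
          (l - w) * (b / z.1) + (u - w) * z.2.1 = (v - w) * z.2.2), hX1, hX2 u hq.1,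
          hX2 v hq.2.1] at this
        exact this
      refine (Finset.sum_le_card_nsmul _ _ _ this).trans ?_
      rw [nsmul_eq_mul]
      refine mul_le_mul_of_nonneg_right ?_ hD₁0
      rw [Finset.card_product, Finset.card_product, h₂]
      have : (Λ₁.erase l).card ≤ M := h₁ ▸ Finset.card_le_card (Finset.erase_subset _ _)
      calc ((M * (M * (Λ₁.erase l).card) : ℕ) : ℝ) ≤ ((M * (M * M) : ℕ) : ℝ) := by gcongr
        _ = _ := by push_cast; ring
    · rw [Nat.cast_sum]
      have : ∀ q ∈ Λ₂.offDiag, ((∑ b ∈ X l, ((A ×ˢ A ×ˢ X q.1).filter fun z =>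
          b / z.1 - b / z.2.1 = (q.1 - q.2) / (q.2 - l) * z.2.2).card : ℕ) : ℝ) ≤ D₂ := by
        rintro ⟨u, v⟩ hq
        simp only [Finset.mem_offDiag] at hq
        have := card_solutions_two_div_le (X := X u) hA hpos
          (div_ne_zero (sub_ne_zero.2 hq.2.2) (hne hl hq.2.1))
        rw [card_filter_product_eq_sum (X l) (A ×ˢ A ×ˢ X u) (fun b z =>
          b / z.1 - b / z.2.1 = (u - v) / (v - l) * z.2.2), hX1, hX2 u hq.1] at this
        exact this
      refine (Finset.sum_le_card_nsmul _ _ _ this).trans ?_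
      rw [nsmul_eq_mul]
      refine mul_le_mul_of_nonneg_right ?_ hD₂0
      rw [Finset.offDiag_card, h₂, sq]
      exact_mod_cast Nat.sub_le _ _
  by_contra! hcon
  have hXne : (X l).Nonempty := Finset.card_pos.1 (by omega)
  have h1 := Finset.sum_lt_sum_of_nonempty hXne hcon
  rw [Finset.sum_const, nsmul_eq_mul, hX1, ← Finset.mul_sum, ← Nat.cast_sum] at h1
  have hτ0 : (0 : ℝ) < τ := by exact_mod_cast hτ
  exact absurd hsum (not_le.2 (lt_of_mul_lt_mul_left h1 hτ0.le))

/-- With ν³ = N and t³ = τ the main terms are M⁴ν²t⁶ and M³ν⁴t⁴. In these variables the hypotheses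
on `M` read M² ≤ ν and Mν ≤ t², just what brings each term below a multiple of M²N τ² = M²ν³t⁶. -/
theorem cluster_parameters_le {M N τ K : ℝ} (hM : 1 ≤ M) (hτ : 1 ≤ τ) (hN : 1 ≤ N)
    (hMN : M ^ 6 ≤ N) (hMτ : M ^ 3 * N ≤ τ ^ 2)
    (hK : τ * K ≤ M * (M ^ 3 * (3 * (N * τ * (τ * τ)) ^ ((2 : ℝ) / 3) + 2 * (τ * τ)) +
      M ^ 2 * (3 * (τ * N * (τ * N)) ^ ((2 : ℝ) / 3) + 2 * (τ * N)))) :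
    K ≤ 10 * (M ^ 2 * N * τ) := by
  obtain ⟨ν, hν0, hν3, -⟩ := exists_cube_root (show 0 ≤ N by linarith)
  obtain ⟨t, ht0, ht3, -⟩ := exists_cube_root (show 0 ≤ τ by linarith)
  have hν1 : 1 ≤ ν := by
    by_contra! h
    have : ν ^ 3 < 1 := pow_lt_one₀ hν0 h (by norm_num)
    linarith
  have ht1 : 1 ≤ t := by
    by_contra! h
    have : t ^ 3 < 1 := pow_lt_one₀ ht0 h (by norm_num)
    linarith
  have hpow : ∀ z : ℝ, 0 ≤ z → (z ^ 3) ^ ((2 : ℝ) / 3) = z ^ 2 := by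
    intro z hz
    rw [← Real.rpow_natCast, ← Real.rpow_mul hz, ← Real.rpow_natCast]
    norm_num
  have e1 : N * τ * (τ * τ) = (ν * t ^ 3) ^ 3 := by
    rw [← hν3, ← ht3]
    ring
  have e2 : τ * N * (τ * N) = (t ^ 2 * ν ^ 2) ^ 3 := by
    rw [← hν3, ← ht3]
    ring
  rw [e1, e2, hpow _ (by positivity), hpow _ (by positivity)] at hK
  have hMν : M ^ 2 ≤ ν := by
    refine le_of_pow_le_pow_left₀ (n := 3) (by norm_num) hν0 ?_
    calc (M ^ 2) ^ 3 = M ^ 6 := by ring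
      _ ≤ ν ^ 3 := by rw [hν3]; exact hMN
  have hMt : M * ν ≤ t ^ 2 := by
    refine le_of_pow_le_pow_left₀ (n := 3) (by norm_num) (by positivity) ?_
    calc (M * ν) ^ 3 = M ^ 3 * ν ^ 3 := by ring
      _ ≤ (t ^ 3) ^ 2 := by rw [hν3, ht3]; exact hMτ
      _ = _ := by ring
  have hM0 : 0 ≤ M := by linarith
  have f1 : τ * τ ≤ (ν * t ^ 3) ^ 2 := by
    rw [← ht3]
    calc t ^ 3 * t ^ 3 = 1 * (t ^ 3) ^ 2 := by ring
      _ ≤ ν ^ 2 * (t ^ 3) ^ 2 := by gcongr; exact one_le_pow₀ hν1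
      _ = _ := by ring
  have f2 : τ * N ≤ (t ^ 2 * ν ^ 2) ^ 2 := by
    rw [← ht3, ← hν3]
    calc t ^ 3 * ν ^ 3 = (t ^ 3 * ν ^ 3) * (1 * 1) := by ring
      _ ≤ (t ^ 3 * ν ^ 3) * (t * ν) := by gcongr
      _ = _ := by ring
  have hτ0 : 0 < τ := by linarith
  refine le_of_mul_le_mul_left (hK.trans ?_) hτ0
  calc _ ≤ M * (M ^ 3 * (3 * (ν * t ^ 3) ^ 2 + 2 * (ν * t ^ 3) ^ 2) +
        M ^ 2 * (3 * (t ^ 2 * ν ^ 2) ^ 2 + 2 * (t ^ 2 * ν ^ 2) ^ 2)) := by gcongr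
    _ = 5 * (M ^ 2 * ν ^ 2 * t ^ 6) * M ^ 2 + 5 * (M ^ 2 * ν ^ 3 * t ^ 4) * (M * ν) := by ring
    _ ≤ 5 * (M ^ 2 * ν ^ 2 * t ^ 6) * ν + 5 * (M ^ 2 * ν ^ 3 * t ^ 4) * t ^ 2 := by gcongr
    _ = τ * (10 * (M ^ 2 * N * τ)) := by
      rw [← hν3, ← ht3]
      ring

/-- Sums of a vector from a line with slope in `Λ₁` and a vector from a line with slope in `Λ₂`:
a positive proportion of the pairs give distinct sums. -/
theorem card_cluster_sums {A : Finset ℝ} (hA : ∀ a ∈ A, 0 < a) (hAne : A.Nonempty)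
    {Λ₁ Λ₂ : Finset ℝ} (hdisj : Disjoint Λ₁ Λ₂) {M τ : ℕ} (hτ : 1 ≤ τ) (hM : 1 ≤ M)
    (h₁ : Λ₁.card = M) (h₂ : Λ₂.card = M)
    (hfib : ∀ l ∈ Λ₁ ∪ Λ₂, τ ≤ (slopeFiber A l).card) (hMN : M ^ 6 ≤ A.card)
    (hMτ : M ^ 3 * A.card ≤ τ ^ 2) (U : Finset (ℝ × ℝ))
    (hU : ∀ l₁ ∈ Λ₁, ∀ l₂ ∈ Λ₂, ∀ b ∈ slopeFiber A l₁, ∀ c ∈ A, ∀ x ∈ slopeFiber A l₂,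
      (b / c + x, l₁ * b / c + l₂ * x) ∈ U) :
    M ^ 2 * A.card * τ ≤ 11 * U.card := by
  classical
  have hXex : ∀ l, ∃ Y ⊆ slopeFiber A l, l ∈ Λ₁ ∪ Λ₂ → Y.card = τ := by
    intro l
    by_cases hl : l ∈ Λ₁ ∪ Λ₂
    · obtain ⟨Y, hY, hc⟩ := Finset.exists_subset_card_eq (hfib l hl)
      exact ⟨Y, hY, fun _ => hc⟩
    · exact ⟨∅, Finset.empty_subset _, fun h => absurd h hl⟩
  choose X hXs hX using hXex
  have hXA : ∀ l, X l ⊆ A := fun l => (hXs l).trans (Finset.filter_subset _ _)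
  set D : ℝ := (M : ℝ) ^ 3 * (3 * ((A.card : ℝ) * τ * (τ * τ)) ^ ((2 : ℝ) / 3) + 2 * (τ * τ)) +
      (M : ℝ) ^ 2 * (3 * ((τ : ℝ) * A.card * (τ * A.card)) ^ ((2 : ℝ) / 3) +
        2 * (τ * A.card)) with hD
  have hbex : ∀ l, ∃ b, l ∈ Λ₁ → b ∈ X l ∧ (τ : ℝ) * coincidenceCost A X Λ₁ Λ₂ l b ≤ D := by
    intro l
    by_cases hl : l ∈ Λ₁
    · obtain ⟨b, hb, h⟩ := exists_coincidenceCost_le hA hdisj hτ h₁ h₂ hXA hX hl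
      exact ⟨b, fun _ => ⟨hb, h⟩⟩
    · exact ⟨0, fun h => absurd h hl⟩
  -- A single numerator `β l` serves each slope of `Λ₁`, so its vectors (β/c, lβ/c) are indexed by c
  -- in A alone.
  choose β hβ using hbex
  have hβ0 : ∀ l ∈ Λ₁, 0 < β l := fun l hl => hA _ (hXA l (hβ l hl).1)
  set T : Finset (ℝ × ℝ × (_ : ℝ) × ℝ) := Λ₁ ×ˢ A ×ˢ Λ₂.sigma X with hT
  have hTcard : T.card = M ^ 2 * A.card * τ := by
    rw [hT, Finset.card_product, Finset.card_product, Finset.card_sigma,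
      Finset.sum_congr rfl fun l hl => hX l (Finset.mem_union_right _ hl), Finset.sum_const,
      h₁, h₂, smul_eq_mul]
    ring
  have hTmem : ∀ {l c : ℝ} {p : (_ : ℝ) × ℝ}, (l, c, p) ∈ T ↔
      l ∈ Λ₁ ∧ c ∈ A ∧ p.1 ∈ Λ₂ ∧ p.2 ∈ X p.1 := by
    intro l c p
    simp [hT]
  set F : ℝ × ℝ × ((_ : ℝ) × ℝ) → ℝ × ℝ := fun z =>
    (β z.1 / z.2.1 + z.2.2.2, z.1 * β z.1 / z.2.1 + z.2.2.1 * z.2.2.2) with hF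
  have hcs := card_sq_le_card_mul_card_coincidences T F U (by
    rintro ⟨l, c, p⟩ hz
    rw [hTmem] at hz
    exact hU l hz.1 p.1 hz.2.2.1 _ (hXs _ (hβ l hz.1).1) c hz.2.1 _ (hXs _ hz.2.2.2))
  set C := (T ×ˢ T).filter fun z => F z.1 = F z.2 with hC
  have hne : ∀ {u v : ℝ}, u ∈ Λ₁ → v ∈ Λ₂ → v - u ≠ 0 := by
    intro u v hu hv h
    rw [sub_eq_zero] at h
    exact Finset.disjoint_left.1 hdisj hu (h ▸ hv)
  have hdivinj : ∀ {b c c' : ℝ}, 0 < b → c ∈ A → c' ∈ A → b / c = b / c' → c = c' := by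
    intro b c c' hb hc hc' h
    have h1 := hA c hc
    have h2 := hA c' hc'
    field_simp at h
    exact h.symm
  -- Vectors on two distinct lines through the origin are determined by their sum.
  have hdiag : (C.filter fun z => z.1.1 = z.2.1 ∧ z.1.2.2.1 = z.2.2.2.1).card ≤ T.card := by
    refine Finset.card_le_card_of_injOn (fun z => z.1) ?_ ?_
    · intro z hz
      exact (Finset.mem_product.1 (Finset.mem_filter.1 (Finset.mem_filter.1 hz).1).1).1
    · have : ∀ z ∈ C.filter fun z => z.1.1 = z.2.1 ∧ z.1.2.2.1 = z.2.2.2.1, z.2 = z.1 := by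
        rintro ⟨⟨l, c, u, x⟩, l', c', u', x'⟩ hz
        simp only [hC, Finset.mem_filter, Finset.mem_product, hTmem] at hz
        obtain ⟨⟨⟨⟨hl, hc, hu, hx⟩, hl', hc', hu', hx'⟩, hFz⟩, h1, h2⟩ := hz
        subst h1
        subst h2
        simp only [hF, Prod.mk.injEq] at hFz
        obtain ⟨e1, e2⟩ := hFz
        have e3 : (u - l) * (x - x') = 0 := by linear_combination e2 - l * e1
        have e4 : x = x' := sub_eq_zero.1 ((mul_eq_zero.1 e3).resolve_left (hne hl hu))
        subst e4
        have e5 : c = c' := hdivinj (hβ0 l hl) hc hc' (add_right_cancel e1)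
        rw [e5]
      intro z hz w hw h
      simp only at h
      exact Prod.ext h (by rw [this z hz, this w hw, h])
  -- Subtracting l' times the first coordinate equation from the second eliminates the term in c',
  -- which the first equation then recovers.
  have hoff₁ : (C.filter fun z => z.1.1 ≠ z.2.1).card ≤
      ∑ l ∈ Λ₁, ∑ q ∈ Λ₂ ×ˢ Λ₂ ×ˢ Λ₁.erase l, ((A ×ˢ X q.1 ×ˢ X q.2.1).filter fun z =>
      (l - q.2.2) * (β l / z.1) + (q.1 - q.2.2) * z.2.1 = (q.2.1 - q.2.2) * z.2.2).card := by
    simp only [← Finset.card_sigma]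
    refine Finset.card_le_card_of_injOn (fun z => ⟨z.1.1, ⟨(z.1.2.2.1, z.2.2.2.1, z.2.1),
      (z.1.2.1, z.1.2.2.2, z.2.2.2.2)⟩⟩) ?_ ?_
    · rintro ⟨⟨l, c, u, x⟩, l', c', u', x'⟩ hz
      simp only [hC, Finset.coe_filter, Set.mem_ofPred_eq, Finset.mem_filter, Finset.mem_product,
        hTmem] at hz
      obtain ⟨⟨⟨⟨hl, hc, hu, hx⟩, hl', hc', hu', hx'⟩, hFz⟩, h1⟩ := hz
      simp only [hF, Prod.mk.injEq] at hFz
      obtain ⟨e1, e2⟩ := hFz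
      simp only [Finset.mem_coe, Finset.mem_sigma, Finset.mem_filter, Finset.mem_product,
        Finset.mem_erase]
      refine ⟨hl, ⟨hu, hu', Ne.symm h1, hl'⟩, ⟨hc, hx, hx'⟩, ?_⟩
      linear_combination e2 - l' * e1
    · rintro ⟨⟨l, c, u, x⟩, l', c', u', x'⟩ hz ⟨⟨l₁, c₁, u₁, x₁⟩, l₁', c₁', u₁', x₁'⟩ hw h
      simp only [hC, Finset.coe_filter, Set.mem_ofPred_eq, Finset.mem_filter, Finset.mem_product,
        hTmem] at hz hw
      simp only [Sigma.mk.injEq, Prod.mk.injEq, heq_eq_eq] at h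
      obtain ⟨rfl, ⟨rfl, rfl, rfl⟩, rfl, rfl, rfl⟩ := h
      have e1 := (Prod.ext_iff.1 hz.1.2).1
      have e2 := (Prod.ext_iff.1 hw.1.2).1
      have : c' = c₁' := hdivinj (hβ0 l' hz.1.1.2.1) hz.1.1.2.2.1 hw.1.1.2.2.1
        (add_right_cancel (e1.symm.trans e2))
      rw [this]
  -- With a common first slope, x' is eliminated instead, and both numerators are the same `β l`.
  have hoff₂ : (C.filter fun z => z.1.1 = z.2.1 ∧ z.1.2.2.1 ≠ z.2.2.2.1).card ≤
      ∑ l ∈ Λ₁, ∑ q ∈ Λ₂.offDiag, ((A ×ˢ A ×ˢ X q.1).filter fun z =>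
      β l / z.1 - β l / z.2.1 = (q.1 - q.2) / (q.2 - l) * z.2.2).card := by
    simp only [← Finset.card_sigma]
    refine Finset.card_le_card_of_injOn (fun z => ⟨z.1.1, ⟨(z.1.2.2.1, z.2.2.2.1),
      (z.1.2.1, z.2.2.1, z.1.2.2.2)⟩⟩) ?_ ?_
    · rintro ⟨⟨l, c, u, x⟩, l', c', u', x'⟩ hz
      simp only [hC, Finset.coe_filter, Set.mem_ofPred_eq, Finset.mem_filter, Finset.mem_product,
        hTmem] at hz
      obtain ⟨⟨⟨⟨hl, hc, hu, hx⟩, hl', hc', hu', hx'⟩, hFz⟩, h1, h2⟩ := hz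
      subst h1
      simp only [hF, Prod.mk.injEq] at hFz
      obtain ⟨e1, e2⟩ := hFz
      simp only [Finset.mem_coe, Finset.mem_sigma, Finset.mem_filter, Finset.mem_product,
        Finset.mem_offDiag]
      refine ⟨hl, ⟨hu, hu', h2⟩, ⟨hc, hc', hx⟩, ?_⟩
      have h3 := hne hl hu'
      rw [div_mul_eq_mul_div, eq_div_iff h3]
      linear_combination u' * e1 - e2
    · rintro ⟨⟨l, c, u, x⟩, l', c', u', x'⟩ hz ⟨⟨l₁, c₁, u₁, x₁⟩, l₁', c₁', u₁', x₁'⟩ hw h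
      simp only [hC, Finset.coe_filter, Set.mem_ofPred_eq, Finset.mem_filter, Finset.mem_product,
        hTmem] at hz hw
      simp only [Sigma.mk.injEq, Prod.mk.injEq, heq_eq_eq] at h
      obtain ⟨rfl, ⟨rfl, rfl⟩, rfl, rfl, rfl⟩ := h
      obtain ⟨⟨-, hz1⟩, hz2, -⟩ := hz
      obtain ⟨⟨-, hw1⟩, hw2, -⟩ := hw
      subst hz2
      subst hw2
      have e1 := (Prod.ext_iff.1 hz1).1
      have e2 := (Prod.ext_iff.1 hw1).1
      have : x' = x₁' := add_left_cancel (e1.symm.trans e2)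
      rw [this]
  have hCle : C.card ≤ T.card + ∑ l ∈ Λ₁, coincidenceCost A X Λ₁ Λ₂ l (β l) := by
    unfold coincidenceCost
    rw [Finset.sum_add_distrib]
    have h1 := Finset.card_filter_add_card_filter_not (s := C) (fun z => z.1.1 ≠ z.2.1)
    have h2 := Finset.card_filter_add_card_filter_not
      (s := C.filter fun z => ¬ z.1.1 ≠ z.2.1) (fun z => z.1.2.2.1 = z.2.2.2.1)
    simp only [Finset.filter_filter, not_not] at h1 h2
    simp only [← ne_eq] at h2
    omega
  have hcost : ∑ l ∈ Λ₁, coincidenceCost A X Λ₁ Λ₂ l (β l) ≤ 10 * T.card := by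
    have h1 : (τ : ℝ) * ((∑ l ∈ Λ₁, coincidenceCost A X Λ₁ Λ₂ l (β l) : ℕ) : ℝ) ≤ M * D := by
      rw [Nat.cast_sum, Finset.mul_sum, ← h₁, ← nsmul_eq_mul]
      exact Finset.sum_le_card_nsmul _ _ _ fun l hl => (hβ l hl).2
    rw [hTcard]
    refine (Nat.cast_le (α := ℝ)).1 ?_
    generalize (∑ l ∈ Λ₁, coincidenceCost A X Λ₁ Λ₂ l (β l)) = K at h1 ⊢
    push_cast
    exact cluster_parameters_le (by exact_mod_cast hM) (by exact_mod_cast hτ)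
      (by exact_mod_cast hAne.card_pos) (by exact_mod_cast hMN) (by exact_mod_cast hMτ) h1
  have hT0 : 0 < T.card := by
    rw [hTcard]
    have := hAne.card_pos
    positivity
  have hfin : T.card * T.card ≤ T.card * (11 * U.card) := by
    calc T.card * T.card = T.card ^ 2 := (sq _).symm
      _ ≤ U.card * C.card := hcs
      _ ≤ U.card * (11 * T.card) := Nat.mul_le_mul_left _ (by omega)
      _ = _ := by ring
  rw [← hTcard]
  exact Nat.le_of_mul_le_mul_left hfin hT0

/-! ### Blocks of consecutive slopes -/

theorem exists_increasing_enumeration (S : Finset ℝ) :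
    ∃ e : ℕ → ℝ, (∀ i < S.card, e i ∈ S) ∧ ∀ i j, i < j → j < S.card → e i < e j := by
  refine ⟨fun i => if h : i < S.card then S.orderEmbOfFin rfl ⟨i, h⟩ else 0, ?_, ?_⟩
  · intro i hi
    simp only [hi, dif_pos]
    exact Finset.orderEmbOfFin_mem _ _ _
  · intro i j hij hj
    simp only [hj, hij.trans hj, dif_pos]
    exact (S.orderEmbOfFin rfl).strictMono (by exact hij)

/-- A sum of two positive vectors has a slope between the slopes of the summands. -/
theorem slope_add_mem_Icc {l₁ l₂ u x p q : ℝ} (hu : 0 < u) (hx : 0 < x) (h₁ : l₁ ∈ Set.Icc p q)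
    (h₂ : l₂ ∈ Set.Icc p q) : (l₁ * u + l₂ * x) / (u + x) ∈ Set.Icc p q := by
  have h : 0 < u + x := by positivity
  rw [Set.mem_Icc, le_div_iff₀ h, div_le_iff₀ h]
  constructor
  · nlinarith [mul_le_mul_of_nonneg_right h₁.1 hu.le, mul_le_mul_of_nonneg_right h₂.1 hx.le]
  · nlinarith [mul_le_mul_of_nonneg_right h₁.2 hu.le, mul_le_mul_of_nonneg_right h₂.2 hx.le]

/-- Summing over consecutive blocks of rich slopes. -/
theorem card_blocks_mul_le {A : Finset ℝ} (hA : ∀ a ∈ A, 0 < a) (hAne : A.Nonempty) {M τ : ℕ}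
    (hτ : 1 ≤ τ) (hM : 1 ≤ M) (hMN : M ^ 6 ≤ A.card) (hMτ : M ^ 3 * A.card ≤ τ ^ 2) :
    (richSlopes A τ).card / (2 * M) * (M ^ 2 * A.card * τ) ≤ 11 * (A / A + A).card ^ 2 := by
  classical
  obtain ⟨e, heS, he⟩ := exists_increasing_enumeration (richSlopes A τ)
  set s := (richSlopes A τ).card with hs
  set q := s / (2 * M) with hq
  have hqs : 2 * M * q ≤ s := Nat.mul_div_le _ _
  have hem : ∀ i j, i ≤ j → j < s → e i ≤ e j := by
    intro i j hij hj
    rcases hij.eq_or_lt with rfl | h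
    · exact le_rfl
    · exact (he i j h hj).le
  have heinj : ∀ i j, i < s → j < s → e i = e j → i = j := by
    intro i j hi hj h
    rcases lt_trichotomy i j with h1 | h1 | h1
    · exact absurd h (he i j h1 hj).ne
    · exact h1
    · exact absurd h (he j i h1 hi).ne'
  set Y := (A / A + A) ×ˢ (A / A + A) with hY
  -- The sector spanned by the j-th block of 2M slopes. Its lower M slopes (offset 0) and upper M
  -- slopes (offset M) serve as `Λ₁` and `Λ₂`; positivity keeps the sums in the sector, and distinct
  -- sectors are disjoint.
  set V : ℕ → Finset (ℝ × ℝ) := fun j => Y.filter fun p =>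
    p.2 / p.1 ∈ Set.Icc (e (2 * M * j)) (e (2 * M * j + (2 * M - 1))) with hV
  have hblock : ∀ j < q, 2 * M * j + (2 * M - 1) < s := by
    intro j hj
    have : 2 * M * (j + 1) ≤ 2 * M * q := Nat.mul_le_mul_left _ hj
    rw [mul_add] at this
    omega
  have hVcard : ∀ j < q, M ^ 2 * A.card * τ ≤ 11 * (V j).card := by
    intro j hj
    have hjs := hblock j hj
    have hcard : ∀ o, o + M ≤ 2 * M →
        ((Finset.range M).image fun i => e (2 * M * j + (o + i))).card = M := by
      intro o ho
      rw [Finset.card_image_of_injOn, Finset.card_range]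
      intro i hi i' hi' h
      simp only [Finset.coe_range, Set.mem_Iio] at hi hi'
      have := heinj _ _ (by omega) (by omega) h
      omega
    have hmem : ∀ o, o + M ≤ 2 * M →
        ∀ l ∈ (Finset.range M).image fun i => e (2 * M * j + (o + i)),
        l ∈ richSlopes A τ ∧ l ∈ Set.Icc (e (2 * M * j)) (e (2 * M * j + (2 * M - 1))) := by
      intro o ho l hl
      obtain ⟨i, hi, rfl⟩ := Finset.mem_image.1 hl
      rw [Finset.mem_range] at hi
      exact ⟨heS _ (by omega), hem _ _ (by omega) (by omega), hem _ _ (by omega) (by omega)⟩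
    have h0 := hmem 0 (by omega)
    have hM' := hmem M (by omega)
    refine card_cluster_sums hA hAne ?_ hτ hM (hcard 0 (by omega)) (hcard M (by omega))
      ?_ hMN hMτ (V j) ?_
    · rw [Finset.disjoint_left]
      intro l hl hl'
      obtain ⟨i, hi, rfl⟩ := Finset.mem_image.1 hl
      obtain ⟨i', hi', h⟩ := Finset.mem_image.1 hl'
      rw [Finset.mem_range] at hi hi'
      have := heinj _ _ (by omega) (by omega) h
      omega
    · intro l hl
      rcases Finset.mem_union.1 hl with hl | hl
      · exact (Finset.mem_filter.1 (h0 l hl).1).2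
      · exact (Finset.mem_filter.1 (hM' l hl).1).2
    · intro l₁ hl₁ l₂ hl₂ b hb c hc x hx
      rw [mem_slopeFiber] at hb hx
      have hpb := hA b hb.1
      have hpc := hA c hc
      have hpx := hA x hx.1
      simp only [hV, hY, Finset.mem_filter, Finset.mem_product]
      refine ⟨⟨Finset.add_mem_add (Finset.div_mem_div hb.1 hc) hx.1,
        Finset.add_mem_add (Finset.div_mem_div hb.2 hc) hx.2⟩, ?_⟩
      rw [mul_div_assoc]
      exact slope_add_mem_Icc (div_pos hpb hpc) hpx (h0 l₁ hl₁).2 (hM' l₂ hl₂).2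
  have hdisj : Set.PairwiseDisjoint (Finset.range q : Set ℕ) V := by
    have hlt : ∀ i j, i < j → j < q → Disjoint (V i) (V j) := by
      intro i j hij hj
      rw [Finset.disjoint_left]
      intro p hp hp'
      have h1 := (Finset.mem_filter.1 hp).2.2
      have h2 := (Finset.mem_filter.1 hp').2.1
      have h3 : 2 * M * (i + 1) ≤ 2 * M * j := Nat.mul_le_mul_left _ hij
      rw [mul_add] at h3
      have h4 := he (2 * M * i + (2 * M - 1)) (2 * M * j) (by omega)
        (by have := hblock j hj; omega)
      linarith
    intro i hi j hj hij
    simp only [Finset.coe_range, Set.mem_Iio] at hi hj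
    rcases lt_or_gt_of_ne hij with h | h
    · exact hlt i j h hj
    · exact (hlt j i h hi).symm
  calc q * (M ^ 2 * A.card * τ) = ∑ j ∈ Finset.range q, M ^ 2 * A.card * τ := by simp
    _ ≤ ∑ j ∈ Finset.range q, 11 * (V j).card :=
      Finset.sum_le_sum fun j hj => hVcard j (Finset.mem_range.1 hj)
    _ = 11 * ((Finset.range q).biUnion V).card := by
      rw [← Finset.mul_sum, Finset.card_biUnion hdisj]
    _ ≤ 11 * Y.card := Nat.mul_le_mul_left _ (Finset.card_le_card
      (Finset.biUnion_subset.2 fun j _ => Finset.filter_subset _ _))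
    _ = 11 * (A / A + A).card ^ 2 := by rw [hY, Finset.card_product, sq]

/-! ### Choice of parameters and conclusion -/

/-- A crude bound, needed only to ensure that there are enough rich slopes to fill a block. -/
theorem harmonic_sq_le {N : ℕ} (hN : 1 ≤ N) : (harmonic N : ℝ) ^ 2 ≤ 9 * N := by
  have h1 : (harmonic N : ℝ) ≤ 1 + Real.log N := harmonic_le_one_add_log N
  have hN' : (1 : ℝ) ≤ N := by exact_mod_cast hN
  have h2 : Real.log N ≤ 2 * Real.sqrt N := by
    have h3 := Real.log_le_self (Real.sqrt_nonneg N)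
    rw [Real.log_sqrt (by linarith)] at h3
    linarith
  have h3 : 1 ≤ Real.sqrt N := Real.one_le_sqrt.2 hN'
  have h4 : (0 : ℝ) < harmonic N := by exact_mod_cast harmonic_pos (by omega)
  calc _ ≤ (3 * Real.sqrt N) ^ 2 := pow_le_pow_left₀ h4.le (by linarith) 2
    _ = 9 * (N : ℝ) := by rw [mul_pow, Real.sq_sqrt (by linarith)]; norm_num

theorem one_le_harmonic {N : ℕ} (hN : 1 ≤ N) : (1 : ℝ) ≤ harmonic N := by
  have h1 : harmonic 1 ≤ harmonic N := by
    rw [harmonic_eq_sum_Icc, harmonic_eq_sum_Icc]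
    refine Finset.sum_le_sum_of_subset_of_nonneg (Finset.Icc_subset_Icc_right hN)
      fun i _ _ => by positivity
  have h2 : harmonic 1 = 1 := by simp [harmonic]
  rw [h2] at h1
  exact_mod_cast h1

/-- The bound when the popular level `τ` is small. -/
theorem card_bound_of_level_small {A : Finset ℝ} (hA : ∀ a ∈ A, 0 < a) (hN : 20 ≤ A.card) {τ : ℕ}
    (hτ : 1 ≤ τ) {H : ℝ} (hH : 1 ≤ H)
    (hpop : (A.card : ℝ) ^ 2 ≤ H * (τ * (richSlopes A τ).card)) (hτN : τ ^ 3 ≤ A.card ^ 2) :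
    (A.card : ℝ) ^ 7 ≤ 1350432 * ((A / A + A).card : ℝ) ^ 4 * H ^ 2 *
      (A.card : ℝ) ^ ((4 : ℝ) / 5) := by
  -- κ = max(1, (τ²/N)^(1/5)), the largest value permitted by the growth alternative when τ² exceeds
  -- N.
  have hκex : ∃ κ : ℝ, 1 ≤ κ ∧ (κ = 1 ∨ κ ^ 5 * A.card = (τ : ℝ) ^ 2) ∧
      (τ : ℝ) ^ 2 ≤ κ ^ 5 * A.card := by
    by_cases h : (τ : ℝ) ^ 2 ≤ A.card
    · exact ⟨1, le_rfl, Or.inl rfl, by simpa using h⟩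
    · push Not at h
      have hN0 : (0 : ℝ) < A.card := by exact_mod_cast (by omega : 0 < A.card)
      have h1 : 1 ≤ (τ : ℝ) ^ 2 / A.card := by
        rw [le_div_iff₀ hN0]
        linarith
      have h5 : (((τ : ℝ) ^ 2 / A.card) ^ ((1 : ℝ) / 5)) ^ 5 = (τ : ℝ) ^ 2 / A.card := by
        rw [← Real.rpow_natCast _ 5, ← Real.rpow_mul (by linarith)]
        norm_num
      have h6 : (((τ : ℝ) ^ 2 / A.card) ^ ((1 : ℝ) / 5)) ^ 5 * A.card = (τ : ℝ) ^ 2 := by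
        rw [h5, div_mul_cancel₀ _ hN0.ne']
      exact ⟨_, Real.one_le_rpow h1 (by norm_num), Or.inr h6, h6.ge⟩
  obtain ⟨κ, hκ1, hκ, hκτ⟩ := hκex
  have hτ1 : (1 : ℝ) ≤ τ := by exact_mod_cast hτ
  have hHτ : 1 ≤ H * τ := one_le_mul_of_one_le_of_one_le hH hτ1
  have hrt : 1 ≤ Real.sqrt (H * τ) := Real.one_le_sqrt.2 hHτ
  -- k₁² s = 625 Hτs ≥ 625 N² by popularity, more than the required 432 N².
  have key := card_richSlopes_mul_le hA hN hτ hκ1 (hκ.imp_right le_of_eq)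
    (k₁ := 25 * Real.sqrt (H * τ)) (by linarith) (by
      rw [mul_pow, Real.sq_sqrt (by linarith)]
      nlinarith [sq_nonneg (A.card : ℝ)])
  have hτN' : (τ : ℝ) ^ 3 ≤ (A.card : ℝ) ^ 2 := by exact_mod_cast hτN
  have hN1 : (1 : ℝ) ≤ A.card := by exact_mod_cast (by omega : 1 ≤ A.card)
  set g : ℝ := (A.card : ℝ) ^ ((4 : ℝ) / 5) with hg
  have hg5 : g ^ 5 = (A.card : ℝ) ^ 4 := by
    rw [hg, ← Real.rpow_natCast _ 5, ← Real.rpow_mul (by linarith), ← Real.rpow_natCast]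
    norm_num
  have hg0 : 0 < g := by positivity
  have hσ0 : (0 : ℝ) ≤ (A / A + A).card := Nat.cast_nonneg _
  generalize ((A / A + A).card : ℝ) = σ at *
  generalize ((richSlopes A τ).card : ℝ) = s at *
  generalize (A.card : ℝ) = N at *
  generalize (τ : ℝ) = t at *
  have ht0 : 0 < t := by linarith
  have hN0 : 0 < N := by linarith
  have hκ0 : 0 < κ := by linarith
  -- This and `htt` bound the contributions of the sparse and the medium lines. The second is sharp
  -- at τ = N^(2/3), which is where the exponent 4/5 comes from.
  have htκ : t * κ ≤ g := by
    refine le_of_pow_le_pow_left₀ (n := 5) (by norm_num) hg0.le ?_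
    rw [hg5]
    rcases hκ with rfl | h
    · refine le_of_pow_le_pow_left₀ (n := 3) (by norm_num) (by positivity) ?_
      calc ((t * 1) ^ 5) ^ 3 = (t ^ 3) ^ 5 := by ring
        _ ≤ (N ^ 2) ^ 5 := by gcongr
        _ = N ^ 10 := by ring
        _ ≤ N ^ 12 := pow_le_pow_right₀ hN1 (by norm_num)
        _ = (N ^ 4) ^ 3 := by ring
    · have h7 : t ^ 7 ≤ N ^ 5 := by
        refine le_of_pow_le_pow_left₀ (n := 3) (by norm_num) (by positivity) ?_
        calc (t ^ 7) ^ 3 = (t ^ 3) ^ 7 := by ring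
          _ ≤ (N ^ 2) ^ 7 := by gcongr
          _ = N ^ 14 := by ring
          _ ≤ N ^ 15 := pow_le_pow_right₀ hN1 (by norm_num)
          _ = (N ^ 5) ^ 3 := by ring
      refine le_of_mul_le_mul_right ?_ hN0
      calc (t * κ) ^ 5 * N = t ^ 5 * (κ ^ 5 * N) := by ring
        _ = t ^ 7 := by rw [h]; ring
        _ ≤ N ^ 5 := h7
        _ = N ^ 4 * N := by ring
  have htt : t * Real.sqrt t ≤ g * κ ^ 3 := by
    refine le_of_pow_le_pow_left₀ (n := 10) (by norm_num) (by positivity) ?_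
    have h1 : (t * Real.sqrt t) ^ 10 = t ^ 15 := by
      have : Real.sqrt t ^ 2 = t := Real.sq_sqrt ht0.le
      calc (t * Real.sqrt t) ^ 10 = t ^ 10 * (Real.sqrt t ^ 2) ^ 5 := by ring
        _ = _ := by rw [this]; ring
    have h2 : (g * κ ^ 3) ^ 10 = N ^ 2 * (κ ^ 5 * N) ^ 6 := by
      calc (g * κ ^ 3) ^ 10 = (g ^ 5) ^ 2 * κ ^ 30 := by ring
        _ = _ := by rw [hg5]; ring
    rw [h1, h2]
    calc t ^ 15 = t ^ 3 * (t ^ 2) ^ 6 := by ring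
      _ ≤ N ^ 2 * (κ ^ 5 * N) ^ 6 := by gcongr
  have hsH : Real.sqrt H ≤ H := by
    rw [Real.sqrt_le_left (by linarith)]
    nlinarith
  have hκ3 : 0 < κ ^ 3 := by positivity
  refine le_of_mul_le_mul_right ?_ hκ3
  have hH0 : 0 ≤ H := by linarith
  -- The final constant is 432 (1 + 125 · 25).
  calc N ^ 7 * κ ^ 3 = N ^ 2 * (N ^ 5 * κ ^ 3) := by ring
    _ ≤ (H * (t * s)) * (N ^ 5 * κ ^ 3) := by gcongr
    _ = (H * t) * (s * N ^ 5 * κ ^ 3) := by ring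
    _ ≤ (H * t) * (432 * σ ^ 4 * (κ ^ 4 + 125 * (25 * Real.sqrt (H * t)))) := by gcongr
    _ = 432 * σ ^ 4 * (H * 1 * (t * κ) * κ ^ 3 + 3125 * (H * Real.sqrt H * (t * Real.sqrt t))) := by
      rw [Real.sqrt_mul (by linarith)]
      ring
    _ ≤ 432 * σ ^ 4 * (H * H * g * κ ^ 3 + 3125 * (H * H * (g * κ ^ 3))) := by gcongr
    _ = 1350432 * σ ^ 4 * H ^ 2 * g * κ ^ 3 := by ring

/-- Eliminating s gives N³m ≤ 44σ²H; squaring and N ≤ 4gm² give the constant 4 · 44² = 7744. It is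
relaxed to match the bound for small τ. -/
theorem pow_seven_le_of_cluster {N g v m s t H σ : ℝ} (hN : 0 ≤ N) (hg : 0 ≤ g) (hm : 0 ≤ m)
    (hv : 0 ≤ v) (hH : 0 ≤ H) (hNg : N ≤ g * v ^ 2) (hvm : v ≤ 2 * m)
    (hpop : N ^ 2 ≤ H * (t * s)) (hs : s * (m * N * t) ≤ 44 * σ ^ 2) :
    N ^ 7 ≤ 1350432 * σ ^ 4 * H ^ 2 * g := by
  have h1 : N ^ 3 * m ≤ 44 * σ ^ 2 * H := by
    calc N ^ 3 * m = N ^ 2 * (N * m) := by ring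
      _ ≤ (H * (t * s)) * (N * m) := by gcongr
      _ = (s * (m * N * t)) * H := by ring
      _ ≤ _ := by gcongr
  calc N ^ 7 = N ^ 6 * N := by ring
    _ ≤ N ^ 6 * (g * (2 * m) ^ 2) := by
      refine mul_le_mul_of_nonneg_left (hNg.trans ?_) (by positivity)
      gcongr
    _ = 4 * g * (N ^ 3 * m) ^ 2 := by ring
    _ ≤ 4 * g * (44 * σ ^ 2 * H) ^ 2 := by gcongr
    _ = 7744 * (σ ^ 4 * H ^ 2 * g) := by ring
    _ ≤ 1350432 * (σ ^ 4 * H ^ 2 * g) :=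
      mul_le_mul_of_nonneg_right (by norm_num) (by positivity)
    _ = _ := by ring

/-- The bound when the popular level `τ` is large. -/
theorem card_bound_of_level_large {A : Finset ℝ} (hA : ∀ a ∈ A, 0 < a) (hN : 216 ≤ A.card) {τ : ℕ}
    (hτ : 1 ≤ τ) (hτA : τ ≤ A.card) {H : ℝ} (hH : 1 ≤ H) (hHN : H ^ 2 ≤ 9 * A.card)
    (hpop : (A.card : ℝ) ^ 2 ≤ H * (τ * (richSlopes A τ).card)) (hτN : A.card ^ 2 ≤ τ ^ 3) :
    (A.card : ℝ) ^ 7 ≤ 1350432 * ((A / A + A).card : ℝ) ^ 4 * H ^ 2 *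
      (A.card : ℝ) ^ ((4 : ℝ) / 5) := by
  have hAne : A.Nonempty := Finset.card_pos.1 (by omega)
  have hN216 : (216 : ℝ) ≤ A.card := by exact_mod_cast hN
  have hN1 : (1 : ℝ) ≤ A.card := by linarith
  -- τ² ≥ N^(4/3) here, so M³N ≤ τ² holds for M up to N^(1/9).
  set v : ℝ := (A.card : ℝ) ^ ((1 : ℝ) / 9) with hv
  have hv9 : v ^ 9 = A.card := by
    rw [hv, ← Real.rpow_natCast _ 9, ← Real.rpow_mul (by linarith)]
    norm_num
  have hv1 : 1 ≤ v := Real.one_le_rpow hN1 (by norm_num)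
  set M := ⌊v⌋₊ with hM
  have hM1 : 1 ≤ M := Nat.le_floor (by simpa using hv1)
  have hMv : (M : ℝ) ≤ v := Nat.floor_le (by linarith)
  have hvM : v ≤ 2 * M := by
    have h1 := (Nat.lt_floor_add_one v).le
    have h2 : (1 : ℝ) ≤ M := by exact_mod_cast hM1
    linarith
  have hM9 : M ^ 9 ≤ A.card := by
    have : (M : ℝ) ^ 9 ≤ A.card := by rw [← hv9]; gcongr
    exact_mod_cast this
  have hMN : M ^ 6 ≤ A.card := (Nat.pow_le_pow_right hM1 (by norm_num)).trans hM9
  have hMτ : M ^ 3 * A.card ≤ τ ^ 2 := by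
    refine le_of_pow_le_pow_left₀ (n := 3) (by norm_num) (by positivity) ?_
    calc (M ^ 3 * A.card) ^ 3 = M ^ 9 * A.card ^ 3 := by ring
      _ ≤ A.card * A.card ^ 3 := Nat.mul_le_mul_right _ hM9
      _ = (A.card ^ 2) ^ 2 := by ring
      _ ≤ (τ ^ 3) ^ 2 := by gcongr
      _ = (τ ^ 2) ^ 3 := by ring
  have key := card_blocks_mul_le hA hAne hτ hM1 hMN hMτ
  -- At least one full block exists, so rounding s/(2M) down costs at most a factor 2. Failure would
  -- give N^7 ≤ 6^18, against N ≥ 216 = 6³.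
  have hs : 2 * M ≤ (richSlopes A τ).card := by
    by_contra! hlt
    have h1 : ((richSlopes A τ).card : ℝ) ≤ 2 * v := by
      have : ((richSlopes A τ).card : ℝ) ≤ ((2 * M : ℕ) : ℝ) := by exact_mod_cast hlt.le
      push_cast at this
      linarith
    have h2 : (τ : ℝ) ≤ A.card := by exact_mod_cast hτA
    have hN0 : (0 : ℝ) < A.card := by linarith
    have hv0 : 0 < v := by linarith
    have h3 : (A.card : ℝ) ≤ H * (2 * v) := by
      refine le_of_mul_le_mul_left ?_ hN0
      calc (A.card : ℝ) * A.card = (A.card : ℝ) ^ 2 := by ring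
        _ ≤ H * (τ * (richSlopes A τ).card) := hpop
        _ ≤ H * (A.card * (2 * v)) := by gcongr
        _ = _ := by ring
    have h4 : (A.card : ℝ) ^ 18 ≤ 6 ^ 18 * (A.card : ℝ) ^ 11 := by
      calc (A.card : ℝ) ^ 18 ≤ (H * (2 * v)) ^ 18 := by gcongr
        _ = 2 ^ 18 * (H ^ 2) ^ 9 * (v ^ 9) ^ 2 := by ring
        _ ≤ 2 ^ 18 * (9 * A.card) ^ 9 * (v ^ 9) ^ 2 := by gcongr
        _ = _ := by
          rw [hv9]
          ring
    have h5 : (A.card : ℝ) ^ 11 * (216 : ℝ) ^ 7 ≤ (A.card : ℝ) ^ 11 * 6 ^ 18 := by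
      calc (A.card : ℝ) ^ 11 * (216 : ℝ) ^ 7 ≤ (A.card : ℝ) ^ 11 * (A.card : ℝ) ^ 7 := by gcongr
        _ = (A.card : ℝ) ^ 18 := by ring
        _ ≤ _ := h4
        _ = _ := by ring
    have h6 : (216 : ℝ) ^ 7 ≤ 6 ^ 18 := le_of_mul_le_mul_left h5 (by positivity)
    norm_num at h6
  have hq : (richSlopes A τ).card ≤ 4 * M * ((richSlopes A τ).card / (2 * M)) := by
    have h1 := Nat.lt_mul_div_succ (richSlopes A τ).card (show 0 < 2 * M by omega)
    have h2 : 1 ≤ (richSlopes A τ).card / (2 * M) := by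
      rw [Nat.one_le_div_iff (by omega)]
      exact hs
    have h3 : 2 * M * 1 ≤ 2 * M * ((richSlopes A τ).card / (2 * M)) := Nat.mul_le_mul_left _ h2
    rw [mul_add] at h1
    have h4 : 4 * M * ((richSlopes A τ).card / (2 * M)) =
        2 * M * ((richSlopes A τ).card / (2 * M)) + 2 * M * ((richSlopes A τ).card / (2 * M)) := by
      ring
    omega
  have h44 : (richSlopes A τ).card * (M * A.card * τ) ≤ 44 * (A / A + A).card ^ 2 := by
    calc (richSlopes A τ).card * (M * A.card * τ) ≤
          (4 * M * ((richSlopes A τ).card / (2 * M))) * (M * A.card * τ) :=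
          Nat.mul_le_mul_right _ hq
      _ = 4 * ((richSlopes A τ).card / (2 * M) * (M ^ 2 * A.card * τ)) := by ring
      _ ≤ 4 * (11 * (A / A + A).card ^ 2) := Nat.mul_le_mul_left _ key
      _ = _ := by ring
  have h44' : ((richSlopes A τ).card : ℝ) * (M * A.card * τ) ≤
      44 * ((A / A + A).card : ℝ) ^ 2 := by exact_mod_cast h44
  set g : ℝ := (A.card : ℝ) ^ ((4 : ℝ) / 5) with hg
  -- There is room to spare: 4/5 + 2/9 > 1.
  have hNg : (A.card : ℝ) ≤ g * v ^ 2 := by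
    have h1 : v ^ 2 = (A.card : ℝ) ^ ((2 : ℝ) / 9) := by
      rw [hv, ← Real.rpow_natCast _ 2, ← Real.rpow_mul (by linarith)]
      norm_num
    rw [h1, hg, ← Real.rpow_add (by linarith)]
    calc (A.card : ℝ) = (A.card : ℝ) ^ (1 : ℝ) := (Real.rpow_one _).symm
      _ ≤ _ := Real.rpow_le_rpow_of_exponent_le hN1 (by norm_num)
  have hg0 : 0 < g := by positivity
  have hM0 : (0 : ℝ) < M := by exact_mod_cast hM1
  have hσ0 : (0 : ℝ) ≤ (A / A + A).card := Nat.cast_nonneg _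
  exact pow_seven_le_of_cluster (by linarith) hg0.le hM0.le (by linarith) (by linarith) hNg hvM
    hpop h44'

/-- The main estimate, with a slightly larger exponent. -/
theorem card_div_add_bound {A : Finset ℝ} (hA : ∀ a ∈ A, 0 < a) (hN : 216 ≤ A.card) :
    (A.card : ℝ) ^ ((31 : ℝ) / 20) ≤ 60 * ((A / A + A).card : ℝ) *
      Real.log A.card ^ ((1 : ℝ) / 2) := by
  have hAne : A.Nonempty := Finset.card_pos.1 (by omega)
  obtain ⟨τ, hτ1, hτN, hpop⟩ := exists_popular_level hA hAne
  have hH := one_le_harmonic (show 1 ≤ A.card by omega)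
  have hmain : (A.card : ℝ) ^ 7 ≤ 1350432 * ((A / A + A).card : ℝ) ^ 4 *
      (harmonic A.card : ℝ) ^ 2 * (A.card : ℝ) ^ ((4 : ℝ) / 5) := by
    rcases le_total (τ ^ 3) (A.card ^ 2) with h | h
    · exact card_bound_of_level_small hA (by omega) hτ1 hH hpop h
    · exact card_bound_of_level_large hA hN hτ1 hτN hH (harmonic_sq_le (by omega)) hpop h
  have hlog : (harmonic A.card : ℝ) ≤ 1 + Real.log A.card := harmonic_le_one_add_log _
  have hN216 : (216 : ℝ) ≤ A.card := by exact_mod_cast hN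
  have hL : 1 ≤ Real.log A.card := by
    rw [Real.le_log_iff_exp_le (by linarith)]
    linarith [Real.exp_one_lt_d9]
  have hH2 : (harmonic A.card : ℝ) ≤ 2 * Real.log A.card := by linarith
  have hσ0 : (0 : ℝ) ≤ (A / A + A).card := Nat.cast_nonneg _
  generalize ((A / A + A).card : ℝ) = σ at *
  generalize (harmonic A.card : ℝ) = H at *
  generalize (A.card : ℝ) = N at *
  generalize Real.log N = L at *
  have hN0 : 0 < N := by linarith
  -- 31/20 = (7 - 4/5)/4, and 4 · 1350432 ≤ 60^4.
  refine le_of_pow_le_pow_left₀ (n := 4) (by norm_num) (by positivity) ?_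
  have hL4 : (L ^ ((1 : ℝ) / 2)) ^ 4 = L ^ 2 := by
    rw [← Real.rpow_natCast _ 4, ← Real.rpow_mul (by linarith), ← Real.rpow_natCast]
    norm_num
  have hN4 : (N ^ ((31 : ℝ) / 20)) ^ 4 * N ^ ((4 : ℝ) / 5) = N ^ 7 := by
    rw [← Real.rpow_natCast _ 4, ← Real.rpow_mul hN0.le, ← Real.rpow_add hN0,
      ← Real.rpow_natCast]
    norm_num
  have hg0 : 0 < N ^ ((4 : ℝ) / 5) := by positivity
  refine le_of_mul_le_mul_right ?_ hg0
  rw [hN4]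
  calc N ^ 7 ≤ 1350432 * σ ^ 4 * H ^ 2 * N ^ ((4 : ℝ) / 5) := hmain
    _ ≤ 1350432 * σ ^ 4 * (2 * L) ^ 2 * N ^ ((4 : ℝ) / 5) := by gcongr
    _ = 5401728 * (σ ^ 4 * L ^ 2 * N ^ ((4 : ℝ) / 5)) := by ring
    _ ≤ 60 ^ 4 * (σ ^ 4 * L ^ 2 * N ^ ((4 : ℝ) / 5)) := by gcongr; norm_num
    _ = (60 * σ * L ^ ((1 : ℝ) / 2)) ^ 4 * N ^ ((4 : ℝ) / 5) := by
      rw [mul_pow, mul_pow, hL4]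
      ring

theorem theorem3 :
    ∃ c : ℝ, 0 < c ∧ ∀ A : Finset ℝ, (∀ a ∈ A, 0 < a) → 2 ≤ A.card →
      c * ((A.card : ℝ) ^ ((3 : ℝ) / 2 + 1 / 26) / Real.log (A.card : ℝ) ^ ((5 : ℝ) / 6)) ≤
        ((A / A + A).card : ℝ) := by
  -- The constant is dictated by |A| < 216, where the power of |A| is at most 216² = 46656, the
  -- power of the logarithm is at least 1/2, and σ ≥ 1.
  refine ⟨1 / 100000, by norm_num, fun A hA h2 => ?_⟩
  have hN2 : (2 : ℝ) ≤ A.card := by exact_mod_cast h2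
  have hL0 : 0 < Real.log A.card := Real.log_pos (by linarith)
  have hσ0 : (0 : ℝ) ≤ (A / A + A).card := Nat.cast_nonneg _
  rcases le_or_gt 216 A.card with hN | hN
  · have key := card_div_add_bound hA hN
    have hN216 : (216 : ℝ) ≤ A.card := by exact_mod_cast hN
    have hL : 1 ≤ Real.log A.card := by
      rw [Real.le_log_iff_exp_le (by linarith)]
      linarith [Real.exp_one_lt_d9]
    have h1 : (A.card : ℝ) ^ ((3 : ℝ) / 2 + 1 / 26) ≤ (A.card : ℝ) ^ ((31 : ℝ) / 20) :=
      Real.rpow_le_rpow_of_exponent_le (by linarith) (by norm_num)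
    have h3 : Real.log A.card ^ ((1 : ℝ) / 2) ≤ Real.log A.card ^ ((5 : ℝ) / 6) :=
      Real.rpow_le_rpow_of_exponent_le hL (by norm_num)
    rw [← mul_div_assoc, div_le_iff₀ (by positivity)]
    have h4 : 60 * ((A / A + A).card : ℝ) * Real.log A.card ^ ((1 : ℝ) / 2) ≤
        60 * ((A / A + A).card : ℝ) * Real.log A.card ^ ((5 : ℝ) / 6) := by gcongr
    have h5 : 0 ≤ ((A / A + A).card : ℝ) * Real.log A.card ^ ((5 : ℝ) / 6) := by positivity
    linarith
  · have hAne : A.Nonempty := Finset.card_pos.1 (by omega)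
    have hσ1 : (1 : ℝ) ≤ (A / A + A).card := by
      exact_mod_cast Finset.card_pos.2 ((hAne.div hAne).add hAne)
    have hN216 : (A.card : ℝ) ≤ 216 := by exact_mod_cast hN.le
    have h1 : (A.card : ℝ) ^ ((3 : ℝ) / 2 + 1 / 26) ≤ 46656 := by
      calc (A.card : ℝ) ^ ((3 : ℝ) / 2 + 1 / 26) ≤ (A.card : ℝ) ^ (2 : ℝ) :=
            Real.rpow_le_rpow_of_exponent_le (by linarith) (by norm_num)
        _ = (A.card : ℝ) ^ 2 := by rw [← Real.rpow_natCast]; norm_num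
        _ ≤ 216 ^ 2 := by gcongr
        _ = 46656 := by norm_num
    have hlog2 : (1 : ℝ) / 2 ≤ Real.log A.card := by
      have := Real.log_le_log (by norm_num) hN2
      linarith [Real.log_two_gt_d9]
    have h3 : (1 : ℝ) / 2 ≤ Real.log A.card ^ ((5 : ℝ) / 6) := by
      calc (1 : ℝ) / 2 = (1 / 2) ^ (1 : ℝ) := (Real.rpow_one _).symm
        _ ≤ (1 / 2) ^ ((5 : ℝ) / 6) :=
          Real.rpow_le_rpow_of_exponent_ge (by norm_num) (by norm_num) (by norm_num)
        _ ≤ _ := Real.rpow_le_rpow (by norm_num) hlog2 (by norm_num)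
    rw [← mul_div_assoc, div_le_iff₀ (by positivity)]
    nlinarith
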